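/- **Theorem 4.3 (Finite activity identification).** Let $G,J:\mathbb{R}^n\to\,]-\infty,+\infty]$ be proper, convex and lower semicontinuous, with $\operatorname{ri}(\operatorname{dom}G)\cap\operatorname{ri}(\operatorname{dom}J)\neq\emptyset$ and $\operatorname{Argmin}(G+J)\neq\emptyset$. Let $\lambda_k\in[0,2]$ with $\sum_{k}\lambda_k(2-\lambda_k)=+\infty$, and let $\gamma_k,\gamma>0$ with $\sum_k\lambda_k|\gamma_k-\gamma|<+\infty$, $(\gamma_k)$ convergent and $\inf_k\gamma_k>0$. Given any $z_0\in\mathbb{R}^n$, let $x_0=\operatorname{prox}_{\gamma_0J}(z_0)$ and, for $k\ge 0$, $$v_{k+1}=\operatorname{prox}_{\gamma_kG}(2x_k-z_k),\qquad z_{k+1}=(1-\lambda_k)z_k+\lambda_k(z_k+v_{k+1}-x_k),\qquad x_{k+1}=\operatorname{prox}_{\gamma_{k+1}J}(z_{k+1}).$$ Then $(z_k,x_k,v_k)\to(z^\star,x^\star,x^\star)$ for some $z^\star$, $x^\star$ with $z^\star\in\operatorname{Fix}(\mathscr F_\gamma)$, where $\mathscr F_\gamma=\frac12\big((2\operatorname{prox}_{\gamma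 G}-\mathrm{Id})\circ(2\operatorname{prox}_{\gamma J}-\mathrm{Id})+\mathrm{Id}\big)$, and $x^\star=\operatorname{prox}_{\gamma J}(z^\star)\in\operatorname{Argmin}(G+J)$. For a convex function $F$ write $T^F_x=\operatorname{par}(\partial F(x))^\perp$, where $\operatorname{par}(C)$ is the linear subspace parallel to the affine hull of $C$. A proper convex lower semicontinuous $F$ with $\partial F(x)\ne\emptyset$ is *partly smooth* at $x$ relative to a set $\mathcal M\ni x$ if $\mathcal M$ is a $C^2$-smooth embedded submanifold of $\mathbb{R}^n$ around $x$ and $F|_{\mathcal M}$ is $C^2$ around $x$; the tangent space $\mathcal T_{\mathcal M}(x)$ equals $T^F_x$; and the set-valued map $\partial F$ is continuous at $x$ relative to $\mathcal M$ (in the Painlevé–Kuratowski sense). Suppose that $G$ and $J$ are partly smooth at $x^\star$ relative to $\mathcal M^G$ and $\mathcal M^J$ respectively, and that the non-degeneracy condition $$x^\star-z^\star\in\gamma\operatorname{ri}(\partial G(x^\star)),\qquad z^\star-x^\star\in\gamma\operatorname{ri}(\partial J(x^\star))\tag{ND}$$ holds. Then there is $K\in\mathbb{N}$ such that: 1. for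 all $k\ge K$, $v_k\in\mathcal M^G$ and $x_k\in\mathcal M^J$; 2. (a) if $\mathcal M^J$ coincides with $x^\star+T^J_{x^\star}$ in a neighbourhood of $x^\star$ (in particular if the two sets are equal), then $T^J_{x_k}=\mathcal T_{\mathcal M^J}(x_k)=T^J_{x^\star}$ for all $k\ge K$; (b) if $\mathcal M^G$ coincides with $x^\star+T^G_{x^\star}$ in a neighbourhood of $x^\star$, then $T^G_{v_k}=\mathcal T_{\mathcal M^G}(v_k)=T^G_{x^\star}$ for all $k\ge K$; (c) if $J$ is locally polyhedral around $x^\star$ (it agrees near $x^\star$ with a function whose epigraph is a polyhedron), then $\mathcal M^J$ coincides with $x^\star+T^J_{x^\star}$ in a neighbourhood of $x^\star$, and for all $k\ge K$: $x_k\in\mathcal M^J\cap(x^\star+T^J_{x^\star})$, $T^J_{x_k}=\mathcal T_{\mathcal M^J}(x_k)=T^J_{x^\star}$, the Riemannian gradients satisfy $\nabla_{\mathcal M^J}J(x_k)=\nabla_{\mathcal M^J}J(x^\star)$, and the Riemannian Hessian satisfies $\nabla^2_{\mathcal M^J}J(x_k)=0$; (d) if $G$ is locally polyhedral around $x^\star$,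 then $\mathcal M^G$ coincides with $x^\star+T^G_{x^\star}$ in a neighbourhood of $x^\star$, and for all $k\ge K$: $v_k\in\mathcal M^G\cap(x^\star+T^G_{x^\star})$, $T^G_{v_k}=\mathcal T_{\mathcal M^G}(v_k)=T^G_{x^\star}$, $\nabla_{\mathcal M^G}G(v_k)=\nabla_{\mathcal M^G}G(x^\star)$, and $\nabla^2_{\mathcal M^G}G(v_k)=0$. -/

import Mathlib

open Filter Topology
open scoped Pointwise InnerProductSpace

noncomputable section

namespace DRSplitting

section ConvexAnalysis

variable {E : Type*} [NormedAddCommGroup E] [InnerProductSpace ℝ E]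

/-- Effective domain of an extended-real-valued function. -/
def effDom (F : E → EReal) : Set E := {x | F x < ⊤}

/-- Epigraph of an extended-real-valued function. -/
def epi (F : E → EReal) : Set (E × ℝ) := {p | F p.1 ≤ (p.2 : EReal)}

/-- The class `Γ₀`: proper, convex, lower semicontinuous functions with values in `]-∞, +∞]`. -/
structure IsGammaZero (F : E → EReal) : Prop where
  ne_bot : ∀ x, F x ≠ ⊥
  dom_nonempty : (effDom F).Nonempty
  convex_epi : Convex ℝ (epi F)
  lsc : LowerSemicontinuous F

/-- Set of (global) minimizers. -/
def argminSet (F : E → EReal) : Set E := {x | ∀ y, F x ≤ F y}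

/-- The convex subdifferential. -/
def subdifferential (F : E → EReal) (x : E) : Set E :=
  {g | ∀ y, F x + ((⟪g, y - x⟫_ℝ : ℝ) : EReal) ≤ F y}

/-- The objective `y ↦ γ F(y) + ½‖y - z‖²` whose minimizer is the proximal point of `z`. -/
def proxObjective (γ : ℝ) (F : E → EReal) (z y : E) : EReal :=
  (γ : EReal) * F y + ((1 / 2 * ‖y - z‖ ^ 2 : ℝ) : EReal)

open Classical in
/-- The proximity operator `prox_{γF}`: the minimizer of `γ F + ½‖· - z‖²`. For `F ∈ Γ₀` and
`γ > 0` the minimizer exists and is unique, so the default value `0` is never used. -/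
def prox (γ : ℝ) (F : E → EReal) (z : E) : E :=
  if h : (argminSet (proxObjective γ F z)).Nonempty then h.choose else 0

/-- The reflected proximity operator `2 prox_{γF} - Id`. -/
def rprox (γ : ℝ) (F : E → EReal) (z : E) : E := (2 : ℝ) • prox γ F z - z

/-- The Douglas–Rachford operator `½ (rprox_{γG} ∘ rprox_{γJ} + Id)`. -/
def drOperator (γ : ℝ) (G J : E → EReal) (z : E) : E :=
  (1 / 2 : ℝ) • (rprox γ G (rprox γ J z) + z)

/-- The sequences `z`, `x`, `v` are generated by the nonstationary Douglas–Rachford iteration with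
step sizes `γ` and relaxation parameters `lam`, from the arbitrary starting point `z 0`. The vector
`v 0` is not produced by the iteration and is left free. -/
structure IsNonstationaryDR (G J : E → EReal) (γ lam : ℕ → ℝ) (z x v : ℕ → E) : Prop where
  x_zero : x 0 = prox (γ 0) J (z 0)
  v_succ : ∀ k, v (k + 1) = prox (γ k) G ((2 : ℝ) • x k - z k)
  z_succ : ∀ k, z (k + 1) = (1 - lam k) • z k + lam k • (z k + v (k + 1) - x k)
  x_succ : ∀ k, x (k + 1) = prox (γ (k + 1)) J (z (k + 1))

/-- The subspace `T_x = par(∂F(x))^⊥`, where `par` is the linear subspace parallel to the affine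
hull. -/
def sharpSubspace (F : E → EReal) (x : E) : Submodule ℝ E :=
  (vectorSpan ℝ (subdifferential F x))ᗮ

/-- A polyhedral set: the intersection of finitely many closed half-spaces. -/
def IsPolyhedralSet {V : Type*} [AddCommGroup V] [Module ℝ V] (C : Set V) : Prop :=
  ∃ s : Finset ((V →ₗ[ℝ] ℝ) × ℝ), C = {p | ∀ q ∈ s, q.1 p ≤ q.2}

/-- `F` is locally polyhedral around `x`: it agrees near `x` with a polyhedral function, i.e. with
one whose epigraph is a polyhedral set. -/
def IsLocallyPolyhedralAt (F : E → EReal) (x : E) : Prop :=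
  ∃ P : E → EReal, IsPolyhedralSet (epi P) ∧ ∀ᶠ y in 𝓝 x, F y = P y

end ConvexAnalysis

section Manifolds

variable {E : Type*} [NormedAddCommGroup E] [InnerProductSpace ℝ E]

/-- `M` is a `C²`-smooth embedded submanifold around `x ∈ M`: near `x` it is the zero set of a
`C²` map with values in some `ℝᵐ` and surjective derivative at `x`. -/
def IsC2ManifoldAround (M : Set E) (x : E) : Prop :=
  x ∈ M ∧ ∃ (m : ℕ) (Φ : E → EuclideanSpace ℝ (Fin m)),
    ContDiffAt ℝ 2 Φ x ∧ Function.Surjective (fderiv ℝ Φ x) ∧ ∀ᶠ y in 𝓝 x, (y ∈ M ↔ Φ y = 0)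

/-- `c` is a curve in `M` through `x` at time `0`, with velocity `h` there. -/
def IsCurveThrough (M : Set E) (x : E) (c : ℝ → E) (h : E) : Prop :=
  c 0 = x ∧ (∀ᶠ t in 𝓝 (0 : ℝ), c t ∈ M) ∧ HasDerivAt c h 0

/-- The tangent space of `M` at `x`: the velocities at `x` of curves in `M`. (At the points where
`M` is a submanifold these already form a linear subspace; taking the span makes the definition a
`Submodule` at every point.) -/
def tangentSpace (M : Set E) (x : E) : Submodule ℝ E :=
  Submodule.span ℝ {h | ∃ c : ℝ → E, IsCurveThrough M x c h}

/-- The restriction of `F` to `M` is `C²` around `x`: it has a real-valued `C²` representative. -/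
def IsC2AlongAround (F : E → EReal) (M : Set E) (x : E) : Prop :=
  ∃ f : E → ℝ, ContDiffAt ℝ 2 f x ∧ ∀ᶠ y in 𝓝[M] x, F y = (f y : EReal)

/-- Continuity (in the sense of Painlevé–Kuratowski) at `x` relative to `M` of a set-valued map. -/
structure IsSetContinuousWithinAt (S : E → Set E) (M : Set E) (x : E) : Prop where
  /-- outer semicontinuity: every limit of points of `S y`, along `y → x` in `M`, lies in `S x` -/
  outer : ∀ u, (∀ V ∈ 𝓝 u, ∃ᶠ y in 𝓝[M] x, (S y ∩ V).Nonempty) → u ∈ S x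
  /-- inner semicontinuity: every point of `S x` is a limit of points of `S y` as `y → x` in `M` -/
  inner : ∀ u ∈ S x, ∀ V ∈ 𝓝 u, ∀ᶠ y in 𝓝[M] x, (S y ∩ V).Nonempty

/-- `F` is partly smooth at `x` relative to `M`. -/
structure IsPartlySmooth (F : E → EReal) (M : Set E) (x : E) : Prop where
  gammaZero : IsGammaZero F
  subdifferential_nonempty : (subdifferential F x).Nonempty
  manifold : IsC2ManifoldAround M x
  smooth : IsC2AlongAround F M x
  sharp : tangentSpace M x = sharpSubspace F x
  continuity : IsSetContinuousWithinAt (subdifferential F) M x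

/-- `g` is the Riemannian gradient at `x` of the restriction of `F` to `M` (with the metric induced
by `E`): the tangent vector whose inner product with the velocity of every curve in `M` through `x`
is the derivative of `F` along this curve. -/
def HasRiemGradientAt (M : Set E) (F : E → EReal) (x g : E) : Prop :=
  g ∈ tangentSpace M x ∧ (∀ᶠ y in 𝓝[M] x, F y ≠ ⊥ ∧ F y ≠ ⊤) ∧
    ∀ (c : ℝ → E) (h : E), IsCurveThrough M x c h →
      HasDerivAt (fun t => (F (c t)).toReal) ⟪g, h⟫_ℝ 0

/-- `H` is the Riemannian Hessian at `x` of the restriction of `F` to `M`: the covariant derivative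
of the Riemannian gradient field, that is, the orthogonal projection onto the tangent space at `x`
of the derivative of the gradient field `N` along curves in `M` through `x`. -/
def HasRiemHessianAt [FiniteDimensional ℝ E] (M : Set E) (F : E → EReal) (x : E)
    (H : tangentSpace M x →ₗ[ℝ] tangentSpace M x) : Prop :=
  ∃ N : E → E, (∀ᶠ y in 𝓝[M] x, HasRiemGradientAt M F y (N y)) ∧
    ∀ (h : tangentSpace M x) (c : ℝ → E), IsCurveThrough M x c h →
      ∃ w : E, HasDerivAt (fun t => N (c t)) w 0 ∧
        (tangentSpace M x).orthogonalProjectionOnto w = H h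

end Manifolds

end DRSplitting

end

open DRSplitting

/-!
Writing `R = rprox_{γG} ∘ rprox_{γJ}`, the iteration reads
`z_{k+1} = (1 - λ_k/2) z_k + (λ_k/2) R_k z_k`, where `R_k` is `R` with step size `γ_k`.

**Convergence.** Proximal maps are resolvents of the monotone subdifferential
(`IsGammaZero.prox_subgradient`), so `R` is nonexpansive, and replacing `γ` by `γ_k` changes it by
at most `|γ_k - γ|` times a linear function of `‖z‖`. The sequence is therefore an inexact
Krasnoselskii–Mann iteration with summable errors, which converges to a fixed point as soon as there
is one (`krasnoselskii_mann_tendsto`). Fixed points correspond to points `x` with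
`0 ∈ ∂G x + ∂J x`; one exists by the sum rule at a minimizer under the relative interior
qualification (`exists_subgradient_of_mem_argminSet`), which rests on Riesz' extension theorem.
The step sizes can only converge to `γ`, hence `x_k` and `v_k` converge as well.

**Identification.** The scaled residuals `(z_k - x_k)/γ_k ∈ ∂J x_k` and
`(2 x_k - z_k - v_{k+1})/γ_k ∈ ∂G v_{k+1}` converge to relative interior points of `∂J x⋆` and
`∂G x⋆`. For a partly smooth function this puts the iterates on the manifold
(`IsPartlySmooth.eventually_mem`): a point off the manifold is displaced from a point of the
manifold along a direction parallel to the limiting subdifferential, and moving the limiting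
subgradient slightly in this direction violates monotonicity.

**Local structure.** Along an affine manifold `∂F` is contained in a translate of the normal space,
and inner semicontinuity prevents its affine hull from losing dimension, so `T_y` is constant
(`IsPartlySmooth.eventually_sharpSubspace_eq`). If `F` is polyhedral near `x⋆`, its epigraph is a
cone near the vertex, so bounded subgradients at nearby points `y` lie in the face of `∂F x⋆`
exposed by `y - x⋆`. For `y` on the manifold this face meets the relative interior, which forces
`y - x⋆ ∈ T_{x⋆}`; hence the manifold is affine and `F` is affine on it
(`IsPartlySmooth.eventually_affine_of_polyhedral`), with constant gradient and zero Hessian.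
-/

noncomputable section

namespace DRSplitting

/-! ### Subgradients through the epigraph -/

section Subgradients

variable {E : Type*} [NormedAddCommGroup E] [InnerProductSpace ℝ E] {F : E → EReal}

theorem ereal_le_of_forall_real_le {a b : EReal} (h : ∀ r : ℝ, b ≤ r → a ≤ r) : a ≤ b := by
  induction b with
  | top => exact le_top
  | coe b => exact h b le_rfl
  | bot =>
    refine le_of_eq ((EReal.eq_bot_iff_forall_lt a).2 fun r => ?_)
    exact (h (r - 1) bot_le).trans_lt (by exact_mod_cast sub_one_lt r)

theorem IsGammaZero.exists_real_of_le (hF : IsGammaZero F) {x : E} {r : ℝ} (h : F x ≤ r) :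
    ∃ a : ℝ, F x = a := by
  have h1 := hF.ne_bot x
  revert h1 h
  induction F x with
  | top => intro h; exact absurd h (by simp)
  | coe a => intros; exact ⟨a, rfl⟩
  | bot => intro _ h; exact absurd rfl h

theorem IsGammaZero.exists_real_of_mem_effDom (hF : IsGammaZero F) {x : E} (h : x ∈ effDom F) :
    ∃ a : ℝ, F x = a := by
  lift F x to ℝ using ⟨ne_of_lt h, hF.ne_bot x⟩ with a ha
  exact ⟨a, rfl⟩

omit [NormedAddCommGroup E] [InnerProductSpace ℝ E] in
theorem mem_epi_of_eq {x : E} {a : ℝ} (h : F x = a) : (x, a) ∈ epi F := h.le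

theorem mem_subdifferential_iff {x g : E} {a : ℝ} (hx : F x = a) :
    g ∈ subdifferential F x ↔ ∀ p ∈ epi F, a + ⟪g, p.1 - x⟫_ℝ ≤ p.2 := by
  constructor
  · intro h p hp
    have := (h p.1).trans hp
    rw [hx] at this
    exact_mod_cast this
  · intro h y
    refine ereal_le_of_forall_real_le fun r hr => ?_
    rw [hx]
    exact_mod_cast h (y, r) hr

theorem IsGammaZero.exists_real_of_mem_subdifferential (hF : IsGammaZero F) {x g : E}
    (hg : g ∈ subdifferential F x) : ∃ a : ℝ, F x = a := by
  obtain ⟨y, hy⟩ := hF.dom_nonempty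
  refine hF.exists_real_of_mem_effDom (Ne.lt_top fun h => ?_ : F x < ⊤)
  have := hg y
  rw [h, EReal.top_add_coe, top_le_iff] at this
  exact (ne_of_lt hy) this

/-- The subdifferential is monotone. -/
theorem IsGammaZero.subdifferential_monotone (hF : IsGammaZero F) {x y u w : E}
    (hu : u ∈ subdifferential F x) (hw : w ∈ subdifferential F y) :
    0 ≤ ⟪u - w, x - y⟫_ℝ := by
  obtain ⟨a, ha⟩ := hF.exists_real_of_mem_subdifferential hu
  obtain ⟨b, hb⟩ := hF.exists_real_of_mem_subdifferential hw
  have h1 := (mem_subdifferential_iff ha).1 hu _ (mem_epi_of_eq hb)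
  have h2 := (mem_subdifferential_iff hb).1 hw _ (mem_epi_of_eq ha)
  simp only at h1 h2
  rw [← neg_sub x y, inner_neg_right] at h1
  rw [inner_sub_left]
  linarith

theorem IsGammaZero.isClosed_epi (hF : IsGammaZero F) : IsClosed (epi F) := by
  have h := hF.lsc.isClosed_epigraph
  exact h.preimage (f := fun p : E × ℝ => (p.1, (p.2 : EReal)))
    (continuous_fst.prodMk (continuous_coe_real_ereal.comp continuous_snd))

theorem IsGammaZero.epi_combo_mem (hF : IsGammaZero F) {p q : E × ℝ} (hp : p ∈ epi F)
    (hq : q ∈ epi F) {t : ℝ} (h0 : 0 ≤ t) (h1 : t ≤ 1) :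
    (p.1 + t • (q.1 - p.1), p.2 + t * (q.2 - p.2)) ∈ epi F := by
  exact hF.convex_epi.add_smul_sub_mem hp hq ⟨h0, h1⟩

end Subgradients

/-! ### Proximal points -/

section Prox

variable {E : Type*} [NormedAddCommGroup E] [InnerProductSpace ℝ E] {F : E → EReal} {γ : ℝ}

omit [InnerProductSpace ℝ E] in
theorem proxObjective_le_iff (hγ : 0 < γ) {z y : E} (c : ℝ) :
    proxObjective γ F z y ≤ c ↔ ∃ r : ℝ, F y ≤ r ∧ γ * r + 1 / 2 * ‖y - z‖ ^ 2 ≤ c := by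
  unfold proxObjective
  constructor
  · intro h
    induction hF : F y with
    | top =>
      rw [hF, EReal.coe_mul_top_of_pos hγ, EReal.top_add_coe] at h
      exact absurd h (by simp)
    | coe a => exact ⟨a, le_rfl, by rw [hF] at h; exact_mod_cast h⟩
    | bot =>
      refine ⟨(c - 1 / 2 * ‖y - z‖ ^ 2) / γ, bot_le, ?_⟩
      field_simp
      linarith
  · rintro ⟨r, hr, h⟩
    have h1 : (γ : EReal) * F y ≤ (γ : EReal) * r :=
      mul_le_mul_of_nonneg_left hr (by exact_mod_cast hγ.le)
    refine (add_le_add_left h1 _).trans ?_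
    exact_mod_cast h

omit [InnerProductSpace ℝ E] in
theorem mem_argminSet_proxObjective_iff (hγ : 0 < γ) {z p : E} {a : ℝ} (hp : F p = a) :
    p ∈ argminSet (proxObjective γ F z) ↔
      ∀ q ∈ epi F, γ * a + 1 / 2 * ‖p - z‖ ^ 2 ≤ γ * q.2 + 1 / 2 * ‖q.1 - z‖ ^ 2 := by
  have h0 : proxObjective γ F z p = ((γ * a + 1 / 2 * ‖p - z‖ ^ 2 : ℝ) : EReal) := by
    unfold proxObjective; rw [hp]; norm_cast
  constructor
  · intro h q hq
    have h1 := (h q.1).trans ((proxObjective_le_iff hγ _).2 ⟨q.2, hq, le_rfl⟩)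
    rw [h0] at h1
    exact_mod_cast h1
  · intro h y
    refine ereal_le_of_forall_real_le fun c hc => ?_
    obtain ⟨r, hr, h1⟩ := (proxObjective_le_iff hγ c).1 hc
    rw [h0]
    exact_mod_cast (h (y, r) hr).trans h1

/-- Fermat's rule for the proximal objective. -/
theorem IsGammaZero.mem_argminSet_proxObjective_iff_subgradient (hF : IsGammaZero F) (hγ : 0 < γ)
    {z p : E} :
    p ∈ argminSet (proxObjective γ F z) ↔ γ⁻¹ • (z - p) ∈ subdifferential F p := by
  constructor
  · intro h
    obtain ⟨a, ha⟩ : ∃ a : ℝ, F p = a := by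
      obtain ⟨y, hy⟩ := hF.dom_nonempty
      obtain ⟨b, hb⟩ := hF.exists_real_of_mem_effDom hy
      obtain ⟨r, hr, -⟩ := (proxObjective_le_iff hγ _).1
        ((h y).trans ((proxObjective_le_iff hγ _).2 ⟨b, hb.le, le_rfl⟩))
      exact hF.exists_real_of_le hr
    rw [mem_subdifferential_iff ha]
    rw [mem_argminSet_proxObjective_iff hγ ha] at h
    intro q hq
    set d := q.1 - p
    have key : ∀ t : ℝ, 0 < t → t ≤ 1 →
        0 ≤ γ * (q.2 - a) - ⟪z - p, d⟫_ℝ + t * (1 / 2 * ‖d‖ ^ 2) := by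
      intro t h0 h1
      have h2 := h _ (hF.epi_combo_mem (mem_epi_of_eq ha) hq h0.le h1)
      simp only at h2
      have h3 : p + t • (q.1 - p) - z = -(z - p) + t • d := by simp only [d]; abel
      rw [h3, norm_add_sq_real, norm_neg, norm_sub_rev z p, inner_neg_left, inner_smul_right,
        norm_smul, Real.norm_of_nonneg h0.le] at h2
      refine nonneg_of_mul_nonneg_right ?_ h0
      nlinarith
    have hlim : Tendsto (fun t : ℝ => γ * (q.2 - a) - ⟪z - p, d⟫_ℝ + t * (1 / 2 * ‖d‖ ^ 2))
        (𝓝[>] 0) (𝓝 (γ * (q.2 - a) - ⟪z - p, d⟫_ℝ + 0 * (1 / 2 * ‖d‖ ^ 2))) := by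
      apply tendsto_nhdsWithin_of_tendsto_nhds
      apply Continuous.tendsto (f := fun t : ℝ => γ * (q.2 - a) - ⟪z - p, d⟫_ℝ + t * (1 / 2 * ‖d‖ ^ 2))
      fun_prop
    have h4 := ge_of_tendsto hlim (by
      filter_upwards [Ioc_mem_nhdsGT (zero_lt_one' ℝ)] with t ht using key t ht.1 ht.2)
    rw [inner_smul_left]
    simp only [conj_trivial]
    have h5 : γ⁻¹ * ⟪z - p, d⟫_ℝ ≤ q.2 - a := by
      rw [inv_mul_le_iff₀ hγ]; linarith
    linarith
  · intro h
    obtain ⟨a, ha⟩ := hF.exists_real_of_mem_subdifferential h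
    rw [mem_argminSet_proxObjective_iff hγ ha]
    intro q hq
    have h1 := (mem_subdifferential_iff ha).1 h q hq
    rw [inner_smul_left] at h1
    simp only [conj_trivial] at h1
    have h5 : ⟪z - p, q.1 - p⟫_ℝ ≤ γ * (q.2 - a) := by
      rw [← inv_mul_le_iff₀ hγ]; linarith
    have h3 : q.1 - z = -(z - p) + (q.1 - p) := by abel
    rw [h3, norm_add_sq_real, norm_neg, norm_sub_rev z p, inner_neg_left]
    nlinarith [sq_nonneg ‖q.1 - p‖]

/-- A function in `Γ₀` on a finite-dimensional space decreases at most linearly: it is bounded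
below on a unit ball around a point of its domain by semicontinuity, hence globally by
convexity. -/
theorem IsGammaZero.exists_linear_lower_bound [FiniteDimensional ℝ E] (hF : IsGammaZero F) :
    ∃ (x₀ : E) (m c : ℝ), 0 ≤ c ∧ ∀ q ∈ epi F, m - c * ‖q.1 - x₀‖ ≤ q.2 := by
  obtain ⟨x₀, hx₀⟩ := hF.dom_nonempty
  obtain ⟨a, ha⟩ := hF.exists_real_of_mem_effDom hx₀
  have : ProperSpace E := FiniteDimensional.proper ℝ E
  obtain ⟨y₁, hy₁, hmin⟩ := LowerSemicontinuousOn.exists_isMinOn (s := Metric.closedBall x₀ 1)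
    (f := F) ⟨x₀, by simp⟩ (isCompact_closedBall x₀ 1) (hF.lsc.lowerSemicontinuousOn _)
  obtain ⟨m, hm⟩ := hF.exists_real_of_le ((hmin (by simp : x₀ ∈ Metric.closedBall x₀ 1)).trans ha.le)
  have hball : ∀ q ∈ epi F, ‖q.1 - x₀‖ ≤ 1 → m ≤ q.2 := by
    intro q hq h
    have h1 : F y₁ ≤ F q.1 := hmin (by simpa [dist_eq_norm] using h)
    rw [hm] at h1
    exact_mod_cast h1.trans hq
  have hma : m ≤ a := hball _ (mem_epi_of_eq ha) (by simp)
  refine ⟨x₀, m, a - m, sub_nonneg.2 hma, fun q hq => ?_⟩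
  rcases le_or_gt ‖q.1 - x₀‖ 1 with h | h
  · have := hball q hq h
    nlinarith [norm_nonneg (q.1 - x₀)]
  · have hpos : 0 < ‖q.1 - x₀‖ := by linarith
    have h1 := hball _ (hF.epi_combo_mem (mem_epi_of_eq ha) hq (t := ‖q.1 - x₀‖⁻¹)
      (by positivity) (inv_le_one_of_one_le₀ h.le)) (by
        simp [norm_smul, hpos.ne'])
    simp only at h1
    have h2 := mul_le_mul_of_nonneg_left h1 hpos.le
    rw [mul_add, ← mul_assoc, mul_inv_cancel₀ hpos.ne'] at h2
    nlinarith

theorem IsGammaZero.argminSet_proxObjective_nonempty [FiniteDimensional ℝ E] (hF : IsGammaZero F)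
    (hγ : 0 < γ) (z : E) : (argminSet (proxObjective γ F z)).Nonempty := by
  obtain ⟨x₀, m, c, hc, hlow⟩ := hF.exists_linear_lower_bound
  obtain ⟨y₀, hy₀⟩ := hF.dom_nonempty
  obtain ⟨b, hb⟩ := hF.exists_real_of_mem_effDom hy₀
  set φ : E × ℝ → ℝ := fun q => γ * q.2 + 1 / 2 * ‖q.1 - z‖ ^ 2 with hφ
  have hcont : Continuous φ := by fun_prop
  set K : Set (E × ℝ) := epi F ∩ {q | φ q ≤ φ (y₀, b)} with hK
  have hKclosed : IsClosed K := hF.isClosed_epi.inter (isClosed_le hcont continuous_const)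
  -- On the sublevel set the quadratic term dominates the linear lower bound.
  have hKbdd : Bornology.IsBounded K := by
    set C := φ (y₀, b)
    set D := ‖z - x₀‖
    set A := 2 * (C - γ * m + γ * c * D) with hA
    set R := |A| + 2 * γ * c + 1 with hR
    have hgc : 0 ≤ γ * c := by positivity
    have hRpos : 0 < R := by have := abs_nonneg A; linarith
    have hKsub : K ⊆ Metric.closedBall z R ×ˢ Set.Icc (m - c * (R + D)) (C / γ) := by
      rintro ⟨y, r⟩ ⟨hq, hle⟩
      change γ * r + 1 / 2 * ‖y - z‖ ^ 2 ≤ C at hle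
      have h1 : m - c * ‖y - x₀‖ ≤ r := hlow _ hq
      have h2 : ‖y - x₀‖ ≤ ‖y - z‖ + D := by
        simpa using norm_add_le (y - z) (z - x₀)
      set s := ‖y - z‖
      have hs : 0 ≤ s := norm_nonneg _
      have h3 : m - c * (s + D) ≤ r := by nlinarith
      have h4 : s ^ 2 ≤ A + 2 * (γ * c) * s := by
        have := mul_le_mul_of_nonneg_left h3 hγ.le
        rw [hA]
        linarith
      have hsR : s ≤ R := by
        by_contra hcon
        push Not at hcon
        have h5 := le_abs_self A
        have h6 := abs_nonneg A
        nlinarith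
      refine ⟨by simpa [dist_eq_norm] using hsR, ?_, ?_⟩
      · have : c * (s + D) ≤ c * (R + D) := by gcongr
        linarith
      · rw [le_div_iff₀ hγ, mul_comm]
        change γ * r ≤ C
        nlinarith [sq_nonneg s]
    have : ProperSpace E := FiniteDimensional.proper ℝ E
    exact (Metric.isBounded_closedBall.prod (Metric.isBounded_Icc _ _)).subset hKsub
  have : ProperSpace E := FiniteDimensional.proper ℝ E
  have hKc : IsCompact K := Metric.isCompact_of_isClosed_isBounded hKclosed hKbdd
  obtain ⟨⟨p, r⟩, hpK, hmin⟩ := hKc.exists_isMinOn ⟨(y₀, b), mem_epi_of_eq hb, le_refl (φ (y₀, b))⟩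
    hcont.continuousOn
  have hmin' : ∀ q ∈ epi F, φ (p, r) ≤ φ q := by
    intro q hq
    rcases le_or_gt (φ q) (φ (y₀, b)) with h | h
    · exact hmin ⟨hq, h⟩
    · exact hpK.2.trans h.le
  obtain ⟨a, ha⟩ := hF.exists_real_of_le (show F p ≤ r from hpK.1)
  refine ⟨p, (mem_argminSet_proxObjective_iff hγ ha).2 fun q hq => ?_⟩
  have har : a ≤ r := by
    have : F p ≤ r := hpK.1
    rw [ha] at this; exact_mod_cast this
  have := hmin' q hq
  simp only [hφ] at this
  nlinarith

/-- `prox_{γF}` is the resolvent of `γ ∂F`. -/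
theorem IsGammaZero.prox_subgradient [FiniteDimensional ℝ E] (hF : IsGammaZero F) (hγ : 0 < γ)
    (z : E) : γ⁻¹ • (z - prox γ F z) ∈ subdifferential F (prox γ F z) := by
  rw [← hF.mem_argminSet_proxObjective_iff_subgradient hγ, prox,
    dif_pos (hF.argminSet_proxObjective_nonempty hγ z)]
  exact (hF.argminSet_proxObjective_nonempty hγ z).choose_spec

theorem IsGammaZero.prox_eq_of_subgradient [FiniteDimensional ℝ E] (hF : IsGammaZero F)
    (hγ : 0 < γ) {z p : E} (hp : γ⁻¹ • (z - p) ∈ subdifferential F p) : prox γ F z = p := by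
  have h := hF.subdifferential_monotone (hF.prox_subgradient hγ z) hp
  rw [← smul_sub, inner_smul_left, sub_sub_sub_cancel_left, ← neg_sub (prox γ F z) p,
    inner_neg_left, real_inner_self_eq_norm_sq] at h
  simp only [conj_trivial] at h
  have h1 : 0 < γ⁻¹ := inv_pos.2 hγ
  have h2 : ‖prox γ F z - p‖ ^ 2 ≤ 0 := by nlinarith
  have h3 : ‖prox γ F z - p‖ = 0 := by nlinarith [norm_nonneg (prox γ F z - p)]
  exact sub_eq_zero.1 (norm_eq_zero.1 h3)

end Prox

/-! ### Relative interiors and the sum rule at a minimizer -/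

section SumRule

variable {E : Type*} [NormedAddCommGroup E] [InnerProductSpace ℝ E]

theorem exists_ball_of_mem_intrinsicInterior {C : Set E} {u : E}
    (hu : u ∈ intrinsicInterior ℝ C) :
    ∃ δ > 0, ∀ d ∈ vectorSpan ℝ C, ‖d‖ < δ → u + d ∈ C := by
  obtain ⟨y, hy, rfl⟩ := mem_intrinsicInterior.1 hu
  obtain ⟨δ, hδ, hsub⟩ := Metric.mem_nhds_iff.1 (mem_interior_iff_mem_nhds.1 hy)
  refine ⟨δ, hδ, fun d hd hdn => ?_⟩
  have hmem : (y : E) + d ∈ affineSpan ℝ C := by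
    rw [add_comm]
    exact AffineSubspace.vadd_mem_of_mem_direction (by rwa [direction_affineSpan]) y.2
  have : (⟨(y : E) + d, hmem⟩ : affineSpan ℝ C) ∈ Metric.ball y δ := by
    rw [Metric.mem_ball, Subtype.dist_eq]
    simpa [dist_eq_norm] using hdn
  exact hsub this

theorem exists_segment_of_mem_intrinsicInterior {C : Set E} {u d : E}
    (hu : u ∈ intrinsicInterior ℝ C) (hd : d ∈ vectorSpan ℝ C) :
    ∃ ε > 0, ∀ t : ℝ, |t| ≤ ε → u + t • d ∈ C := by
  obtain ⟨δ, hδ, h⟩ := exists_ball_of_mem_intrinsicInterior hu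
  refine ⟨δ / (‖d‖ + 1), by positivity, fun t ht => h _ (Submodule.smul_mem _ _ hd) ?_⟩
  rw [norm_smul, Real.norm_eq_abs]
  calc |t| * ‖d‖ ≤ δ / (‖d‖ + 1) * ‖d‖ := by gcongr
    _ < δ := by
      rw [div_mul_eq_mul_div, div_lt_iff₀ (by positivity)]
      nlinarith

/-- Fermat's rule and the sum rule for subdifferentials under the relative interior qualification.
The cone generated by the epigraph of `d ↦ inf_{a - b = d} G a + J b - min (G + J)` meets the
vertical line only in its upper half, and Riesz' extension theorem yields a linear functional that
is nonnegative on that cone. -/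
theorem exists_subgradient_of_mem_argminSet [FiniteDimensional ℝ E] {G J : E → EReal}
    (hG : IsGammaZero G) (hJ : IsGammaZero J)
    (hri : (intrinsicInterior ℝ (effDom G) ∩ intrinsicInterior ℝ (effDom J)).Nonempty) {x : E}
    (hx : x ∈ argminSet (fun y => G y + J y)) :
    ∃ u, u ∈ subdifferential G x ∧ -u ∈ subdifferential J x := by
  obtain ⟨y₀, hyG, hyJ⟩ := hri
  obtain ⟨g₀, hg₀⟩ := hG.exists_real_of_mem_effDom (intrinsicInterior_subset hyG)
  obtain ⟨j₀, hj₀⟩ := hJ.exists_real_of_mem_effDom (intrinsicInterior_subset hyJ)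
  have hlt : G x + J x < ⊤ := by
    refine (hx y₀).trans_lt ?_
    simp only [hg₀, hj₀]
    exact_mod_cast EReal.coe_lt_top (g₀ + j₀)
  obtain ⟨hGx, hJx⟩ : G x < ⊤ ∧ J x < ⊤ := by
    constructor <;> by_contra h <;> rw [not_lt, top_le_iff] at h <;> rw [h] at hlt
    · rw [EReal.top_add_of_ne_bot (hJ.ne_bot x)] at hlt; exact lt_irrefl _ hlt
    · rw [EReal.add_top_of_ne_bot (hG.ne_bot x)] at hlt; exact lt_irrefl _ hlt
  obtain ⟨a, ha⟩ := hG.exists_real_of_mem_effDom hGx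
  obtain ⟨b, hb⟩ := hJ.exists_real_of_mem_effDom hJx
  have hmin : ∀ y (r s : ℝ), (y, r) ∈ epi G → (y, s) ∈ epi J → a + b ≤ r + s := by
    intro y r s hr hs
    have h1 := (hx y).trans (add_le_add hr hs)
    simp only [ha, hb] at h1
    exact_mod_cast h1
  -- The two epigraphs combined into a convex set of `E × ℝ`.
  set L : (E × ℝ) × (E × ℝ) →ₗ[ℝ] E × ℝ :=
    { toFun := fun p => (p.1.1 - p.2.1, p.1.2 + p.2.2)
      map_add' := fun p q => by ext <;> simp <;> [abel; ring]
      map_smul' := fun c p => by ext <;> simp [smul_sub, mul_add] } with hL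
  set S : Set (E × ℝ) := (fun q => -(0, a + b) + q) '' (L '' (epi G ×ˢ epi J)) with hS
  have hSconv : Convex ℝ S := by
    have h1 := (hG.convex_epi.prod hJ.convex_epi).linear_image L
    exact h1.translate _
  have hmemS : ∀ p ∈ epi G, ∀ q ∈ epi J, (p.1 - q.1, p.2 + q.2 - (a + b)) ∈ S := by
    intro p hp q hq
    exact ⟨_, ⟨(p, q), ⟨hp, hq⟩, rfl⟩, by simp [hL, sub_eq_neg_add]⟩
  have h0S : (0 : E × ℝ) ∈ S := by
    have := hmemS _ (mem_epi_of_eq ha) _ (mem_epi_of_eq hb)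
    simpa only [sub_self, Prod.mk_zero_zero] using this
  set V : Submodule ℝ E := vectorSpan ℝ (effDom G) ⊔ vectorSpan ℝ (effDom J) with hV
  have hSV : ∀ q ∈ S, q.1 ∈ V ∧ (q.1 = 0 → 0 ≤ q.2) := by
    rintro _ ⟨_, ⟨⟨p, q⟩, ⟨hp, hq⟩, rfl⟩, rfl⟩
    have hp' : p.1 ∈ effDom G := lt_of_le_of_lt hp (EReal.coe_lt_top _)
    have hq' : q.1 ∈ effDom J := lt_of_le_of_lt hq (EReal.coe_lt_top _)
    simp only [hL, LinearMap.coe_mk, AddHom.coe_mk, Prod.fst_add, Prod.snd_add,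
      Prod.fst_neg, Prod.snd_neg, neg_zero, zero_add]
    constructor
    · have h1 : p.1 - q.1 = (p.1 - y₀) - (q.1 - y₀) := by abel
      rw [h1]
      exact V.sub_mem
        (Submodule.mem_sup_left (vsub_mem_vectorSpan ℝ hp' (intrinsicInterior_subset hyG)))
        (Submodule.mem_sup_right (vsub_mem_vectorSpan ℝ hq' (intrinsicInterior_subset hyJ)))
    · intro h
      have h1 : p.1 = q.1 := sub_eq_zero.1 h
      have := hmin p.1 p.2 q.2 hp (h1 ▸ hq)
      linarith
  set K := ConvexCone.hull ℝ S with hK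
  have hmemK : ∀ q, q ∈ K ↔ ∃ c : ℝ, 0 < c ∧ c • q ∈ S := fun q => by
    rw [hK, ConvexCone.mem_hull_of_convex hSconv]
    constructor
    · rintro ⟨r, hr, p, hp, rfl⟩
      exact ⟨r⁻¹, inv_pos.2 hr, by simpa [smul_smul, hr.ne'] using hp⟩
    · rintro ⟨c, hc, hq⟩
      exact ⟨c⁻¹, inv_pos.2 hc, c • q, hq, by simp [smul_smul, hc.ne']⟩
  have hKp : K.Pointed := (hmemK 0).2 ⟨1, one_pos, by simpa using h0S⟩
  -- The height functional on `Vᗮ × ℝ`: the cone lies over `V`, so it meets this domain only in the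
  -- vertical half-line, and `Vᗮ` supplies the directions which the two domains do not span.
  set f : E × ℝ →ₗ.[ℝ] ℝ := ⟨Vᗮ.prod ⊤, (LinearMap.snd ℝ E ℝ).comp (Submodule.subtype _)⟩ with hf
  obtain ⟨φ, hφ, hpos⟩ := riesz_extension (K.toPointedCone hKp) f (by
    rintro ⟨⟨d, r⟩, hd⟩ hK'
    obtain ⟨c, hc, hcS⟩ := (hmemK _).1 hK'
    obtain ⟨h1, h2⟩ := hSV _ hcS
    have hd' : d ∈ Vᗮ := hd.1
    have hdV : d ∈ V := by
      have := V.smul_mem c⁻¹ h1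
      simpa [hc.ne'] using this
    have hd0 : d = 0 := by
      have := Submodule.inner_right_of_mem_orthogonal hdV hd'
      exact inner_self_eq_zero.1 this
    have h3 := h2 (by simp [hd0])
    simp only [Prod.smul_snd, smul_eq_mul] at h3
    exact nonneg_of_mul_nonneg_right h3 hc) (by
    rintro ⟨d, r⟩
    obtain ⟨v, hv, w, hw, hvw⟩ := V.exists_add_mem_mem_orthogonal d
    obtain ⟨d₁, hd₁, d₂, hd₂, h12⟩ := Submodule.mem_sup.1 hv
    obtain ⟨ε₁, hε₁, h1⟩ := exists_segment_of_mem_intrinsicInterior hyG hd₁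
    obtain ⟨ε₂, hε₂, h2⟩ := exists_segment_of_mem_intrinsicInterior hyJ hd₂
    set t := min ε₁ ε₂ with ht
    have htpos : 0 < t := lt_min hε₁ hε₂
    obtain ⟨α, hα⟩ := hG.exists_real_of_mem_effDom
      (h1 t (by rw [abs_of_pos htpos]; exact min_le_left _ _))
    obtain ⟨β, hβ⟩ := hJ.exists_real_of_mem_effDom
      (h2 (-t) (by rw [abs_neg, abs_of_pos htpos]; exact min_le_right _ _))
    have h3 := hmemS _ (mem_epi_of_eq hα) _ (mem_epi_of_eq hβ)
    simp only at h3
    refine ⟨⟨(-w, t⁻¹ * (α + β - (a + b)) - r), Vᗮ.neg_mem hw, trivial⟩, ?_⟩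
    rw [ConvexCone.mem_toPointedCone, hmemK]
    refine ⟨t, htpos, ?_⟩
    convert h3 using 1
    ext
    · simp only [Prod.mk_add_mk, Prod.smul_mk, hvw, ← h12]
      module
    · simp only [Prod.mk_add_mk, Prod.smul_mk, smul_eq_mul]
      field_simp
      ring)
  have hφ01 : φ (0, 1) = 1 := by
    have := hφ ⟨(0, 1), Vᗮ.zero_mem, trivial⟩
    exact this
  set ψ : E →L[ℝ] ℝ := LinearMap.toContinuousLinearMap (φ.comp (LinearMap.inl ℝ E ℝ)) with hψ
  set u : E := -(InnerProductSpace.toDual ℝ E).symm ψ with hu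
  have hφu : ∀ d r, φ (d, r) = r - ⟪u, d⟫_ℝ := by
    intro d r
    have h1 : ⟪u, d⟫_ℝ = - φ (d, 0) := by
      rw [hu, inner_neg_left, InnerProductSpace.toDual_symm_apply]
      simp [hψ]
    have h2 : ((d, r) : E × ℝ) = (d, 0) + r • (0, 1) := by simp
    rw [h2, map_add, map_smul, hφ01, h1]
    simp
    ring
  have hkey : ∀ p ∈ epi G, ∀ q ∈ epi J, a + b + ⟪u, p.1 - q.1⟫_ℝ ≤ p.2 + q.2 := by
    intro p hp q hq
    have h1 := hpos _ ((ConvexCone.mem_toPointedCone hKp _).2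
      ((hmemK _).2 ⟨1, one_pos, by simpa using hmemS p hp q hq⟩))
    rw [hφu] at h1
    linarith
  refine ⟨u, (mem_subdifferential_iff ha).2 fun p hp => ?_,
    (mem_subdifferential_iff hb).2 fun q hq => ?_⟩
  · have := hkey p hp _ (mem_epi_of_eq hb)
    simp only at this
    linarith
  · have := hkey _ (mem_epi_of_eq ha) q hq
    simp only at this
    rw [← neg_sub q.1 x, inner_neg_right] at this
    rw [inner_neg_left]
    linarith

theorem mem_argminSet_add_of_subgradient {G J : E → EReal} (hG : IsGammaZero G)
    (hJ : IsGammaZero J) {x u : E} (hu : u ∈ subdifferential G x) (hu' : -u ∈ subdifferential J x) :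
    x ∈ argminSet (fun y => G y + J y) := by
  obtain ⟨a, ha⟩ := hG.exists_real_of_mem_subdifferential hu
  obtain ⟨b, hb⟩ := hJ.exists_real_of_mem_subdifferential hu'
  intro y
  have h := add_le_add (hu y) (hu' y)
  refine le_trans (le_of_eq ?_) h
  simp only [ha, hb, inner_neg_left]
  norm_cast
  ring

end SumRule

/-! ### Nonexpansiveness and dependence on the step size -/

section Resolvents

variable {E : Type*} [NormedAddCommGroup E] [InnerProductSpace ℝ E] [FiniteDimensional ℝ E]
  {F : E → EReal} {γ γ' : ℝ}

theorem IsGammaZero.inner_prox_sub_prox (hF : IsGammaZero F) (hγ : 0 < γ) (z w : E) :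
    ‖prox γ F z - prox γ F w‖ ^ 2 ≤ ⟪z - w, prox γ F z - prox γ F w⟫_ℝ := by
  have h := hF.subdifferential_monotone (hF.prox_subgradient hγ z) (hF.prox_subgradient hγ w)
  rw [← smul_sub, inner_smul_left, sub_sub_sub_comm, inner_sub_left,
    real_inner_self_eq_norm_sq] at h
  have := nonneg_of_mul_nonneg_right h (inv_pos.2 hγ)
  linarith

theorem IsGammaZero.norm_prox_sub_prox_le (hF : IsGammaZero F) (hγ : 0 < γ) (z w : E) :
    ‖prox γ F z - prox γ F w‖ ≤ ‖z - w‖ := by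
  have h1 := (hF.inner_prox_sub_prox hγ z w).trans (real_inner_le_norm _ _)
  by_contra hcon
  push Not at hcon
  nlinarith [norm_nonneg (z - w)]

theorem IsGammaZero.norm_rprox_sub_rprox_le (hF : IsGammaZero F) (hγ : 0 < γ) (z w : E) :
    ‖rprox γ F z - rprox γ F w‖ ≤ ‖z - w‖ := by
  have h1 := hF.inner_prox_sub_prox hγ z w
  have h2 : rprox γ F z - rprox γ F w = (2 : ℝ) • (prox γ F z - prox γ F w) - (z - w) := by
    simp only [rprox]; module
  refine le_of_sq_le_sq ?_ (norm_nonneg _)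
  rw [h2, norm_sub_sq_real, norm_smul, inner_smul_left, real_inner_comm]
  simp only [conj_trivial, Real.norm_ofNat]
  nlinarith

theorem IsGammaZero.norm_prox_sub_prox_le_of_step (hF : IsGammaZero F) (hγ : 0 < γ)
    (hγ' : 0 < γ') (z : E) :
    ‖prox γ' F z - prox γ F z‖ ≤ |γ' - γ| / γ * ‖z - prox γ F z‖ := by
  set p := prox γ F z
  set p' := prox γ' F z
  have h := hF.subdifferential_monotone (hF.prox_subgradient hγ z) (hF.prox_subgradient hγ' z)
  have h2 := mul_nonneg hγ'.le h
  rw [← real_inner_smul_left] at h2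
  have h3 : γ' • (γ⁻¹ • (z - p) - γ'⁻¹ • (z - p')) =
      ((γ' - γ) / γ) • (z - p) - (p - p') := by
    rw [smul_sub, smul_smul, smul_smul, mul_inv_cancel₀ hγ'.ne', one_smul, sub_div,
      div_self hγ.ne', div_eq_mul_inv]
    module
  change 0 ≤ ⟪γ' • (γ⁻¹ • (z - p) - γ'⁻¹ • (z - p')), p - p'⟫_ℝ at h2
  rw [h3, inner_sub_left, real_inner_self_eq_norm_sq] at h2
  have h4 := real_inner_le_norm (((γ' - γ) / γ) • (z - p)) (p - p')
  rw [norm_smul, Real.norm_eq_abs, abs_div, abs_of_pos hγ] at h4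
  rw [norm_sub_rev p' p]
  have h5 : 0 ≤ |γ' - γ| / γ * ‖z - p‖ := by positivity
  by_contra hcon
  push Not at hcon
  nlinarith [norm_nonneg (p - p')]

theorem IsGammaZero.norm_rprox_sub_rprox_le_of_step (hF : IsGammaZero F) (hγ : 0 < γ)
    (hγ' : 0 < γ') (z : E) :
    ‖rprox γ' F z - rprox γ F z‖ ≤ |γ' - γ| / γ * ‖z - rprox γ F z‖ := by
  have h1 : rprox γ' F z - rprox γ F z = (2 : ℝ) • (prox γ' F z - prox γ F z) := by
    simp only [rprox]; module
  have h2 : z - rprox γ F z = (2 : ℝ) • (z - prox γ F z) := by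
    simp only [rprox]; module
  rw [h1, h2, norm_smul, norm_smul]
  have := hF.norm_prox_sub_prox_le_of_step hγ hγ' z
  simp only [Real.norm_ofNat]
  linarith

/-- Joint continuity of the proximal map in the step size and the point. -/
theorem IsGammaZero.tendsto_prox (hF : IsGammaZero F) (hγ : 0 < γ) {γs : ℕ → ℝ}
    (hγs : ∀ k, 0 < γs k) (hlim : Tendsto γs atTop (𝓝 γ)) {y : ℕ → E} {w : E}
    (hy : Tendsto y atTop (𝓝 w)) :
    Tendsto (fun k => prox (γs k) F (y k)) atTop (𝓝 (prox γ F w)) := by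
  rw [tendsto_iff_norm_sub_tendsto_zero]
  have h0 : Tendsto (fun k => ‖y k - w‖ + |γs k - γ| / γ * ‖w - prox γ F w‖) atTop
      (𝓝 (‖w - w‖ + |γ - γ| / γ * ‖w - prox γ F w‖)) :=
    (hy.sub_const w).norm.add ((((hlim.sub_const γ).abs).div_const γ).mul_const _)
  simp only [sub_self, norm_zero, abs_zero, zero_div, zero_mul, add_zero] at h0
  refine squeeze_zero (fun _ => norm_nonneg _) (fun k => ?_) h0
  have h1 := hF.norm_prox_sub_prox_le (hγs k) (y k) w
  have h2 := hF.norm_prox_sub_prox_le_of_step hγ (hγs k) w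
  calc ‖prox (γs k) F (y k) - prox γ F w‖
      ≤ ‖prox (γs k) F (y k) - prox (γs k) F w‖ + ‖prox (γs k) F w - prox γ F w‖ :=
        norm_sub_le_norm_sub_add_norm_sub _ _ _
    _ ≤ _ := add_le_add h1 h2

end Resolvents

/-! ### Inexact Krasnoselskii–Mann iterations -/

section KrasnoselskiiMann

theorem exists_bound_of_le_one_add_mul {A ε : ℕ → ℝ} (hε : ∀ k, 0 ≤ ε k) (hsum : Summable ε)
    (hA : ∀ k, 0 ≤ A k) (h : ∀ k, A (k + 1) ≤ (1 + ε k) * A k) : ∃ C, ∀ k, A k ≤ C := by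
  have key : ∀ k, A k ≤ A 0 * Real.exp (∑ i ∈ Finset.range k, ε i) := by
    intro k
    induction k with
    | zero => simp
    | succ k ih =>
      rw [Finset.sum_range_succ, Real.exp_add]
      have h1 : 1 + ε k ≤ Real.exp (ε k) := by
        rw [add_comm]; exact Real.add_one_le_exp _
      calc A (k + 1) ≤ (1 + ε k) * A k := h k
        _ ≤ Real.exp (ε k) * (A 0 * Real.exp (∑ i ∈ Finset.range k, ε i)) :=
          mul_le_mul h1 ih (hA k) (Real.exp_pos _).le
        _ = _ := by ring
  refine ⟨A 0 * Real.exp (∑' i, ε i), fun k => (key k).trans ?_⟩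
  have := hsum.sum_le_tsum (Finset.range k) (fun i _ => hε i)
  exact mul_le_mul_of_nonneg_left (Real.exp_le_exp.2 this) (hA 0)

/-- A nonnegative sequence that is decreasing up to summable errors converges. -/
theorem exists_tendsto_of_le_add_summable {a e : ℕ → ℝ} (ha : ∀ k, 0 ≤ a k) (he : ∀ k, 0 ≤ e k)
    (hsum : Summable e) (h : ∀ k, a (k + 1) ≤ a k + e k) : ∃ l, Tendsto a atTop (𝓝 l) := by
  set c : ℕ → ℝ := fun k => a k - ∑ i ∈ Finset.range k, e i with hc
  have hanti : Antitone c := antitone_nat_of_succ_le fun k => by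
    simp only [hc, Finset.sum_range_succ]
    linarith [h k]
  have hbdd : BddBelow (Set.range c) := by
    refine ⟨-∑' i, e i, ?_⟩
    rintro _ ⟨k, rfl⟩
    have := hsum.sum_le_tsum (Finset.range k) (fun i _ => he i)
    simp only [hc]
    linarith [ha k]
  refine ⟨_, ((tendsto_atTop_ciInf hanti hbdd).add hsum.hasSum.tendsto_sum_nat).congr fun k => ?_⟩
  simp only [hc]
  ring

variable {E : Type*} [NormedAddCommGroup E] [InnerProductSpace ℝ E]

theorem norm_sq_relaxation (μ : ℝ) (a b : E) :
    ‖(1 - μ) • a + μ • b‖ ^ 2 =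
      (1 - μ) * ‖a‖ ^ 2 + μ * ‖b‖ ^ 2 - μ * (1 - μ) * ‖a - b‖ ^ 2 := by
  rw [norm_add_sq_real, norm_sub_sq_real, norm_smul, norm_smul, inner_smul_left, inner_smul_right,
    mul_pow, mul_pow, Real.norm_eq_abs, Real.norm_eq_abs, sq_abs, sq_abs]
  simp only [conj_trivial]
  ring

/-- Relaxed iterations of a nonexpansive map with summable errors converge to a fixed point. The
iterates are quasi-Fejér monotone with respect to the fixed points; divergence of
`∑ μ (1 - μ)` forces the residual to be small infinitely often, so in finite dimension some cluster
point is fixed, and the distance to that point, which converges, tends to zero. -/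
theorem krasnoselskii_mann_tendsto [FiniteDimensional ℝ E] {R : E → E}
    (hR : ∀ x y, ‖R x - R y‖ ≤ ‖x - y‖) {q : E} (hq : R q = q) {μ : ℕ → ℝ}
    (hμ : ∀ k, μ k ∈ Set.Icc (0 : ℝ) 1)
    (hdiv : Tendsto (fun N => ∑ k ∈ Finset.range N, μ k * (1 - μ k)) atTop atTop)
    {z : ℕ → E} {e : ℕ → ℝ} (he : Summable e)
    (hz : ∀ k, ‖z (k + 1) - ((1 - μ k) • z k + μ k • R (z k))‖ ≤ e k) :
    ∃ p, R p = p ∧ Tendsto z atTop (𝓝 p) := by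
  have he0 : ∀ k, 0 ≤ e k := fun k => (norm_nonneg _).trans (hz k)
  have hsq : ∀ p, R p = p → ∀ k, ‖(1 - μ k) • z k + μ k • R (z k) - p‖ ^ 2 ≤
      ‖z k - p‖ ^ 2 - μ k * (1 - μ k) * ‖z k - R (z k)‖ ^ 2 := by
    intro p hp k
    have h1 : (1 - μ k) • z k + μ k • R (z k) - p =
        (1 - μ k) • (z k - p) + μ k • (R (z k) - p) := by module
    rw [h1, norm_sq_relaxation, sub_sub_sub_cancel_right]
    have h2 : ‖R (z k) - p‖ ≤ ‖z k - p‖ := by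
      have := hR (z k) p
      rwa [hp] at this
    have h3 : ‖R (z k) - p‖ ^ 2 ≤ ‖z k - p‖ ^ 2 := by gcongr
    nlinarith [(hμ k).1]
  have hstep : ∀ p, R p = p → ∀ k,
      ‖(1 - μ k) • z k + μ k • R (z k) - p‖ ≤ ‖z k - p‖ := by
    intro p hp k
    refine le_of_sq_le_sq ((hsq p hp k).trans ?_) (norm_nonneg _)
    have := mul_nonneg (mul_nonneg (hμ k).1 (sub_nonneg.2 (hμ k).2)) (sq_nonneg ‖z k - R (z k)‖)
    linarith
  have hdist : ∀ p k, ‖z (k + 1) - p‖ ≤ ‖(1 - μ k) • z k + μ k • R (z k) - p‖ + e k := by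
    intro p k
    have := norm_sub_le_norm_sub_add_norm_sub (z (k + 1)) ((1 - μ k) • z k + μ k • R (z k)) p
    linarith [hz k]
  have hconv : ∀ p, R p = p → ∃ l, Tendsto (fun k => ‖z k - p‖) atTop (𝓝 l) := fun p hp =>
    exists_tendsto_of_le_add_summable (fun _ => norm_nonneg _) he0 he fun k =>
      (hdist p k).trans (add_le_add_left (hstep p hp k) _)
  obtain ⟨l, hl⟩ := hconv q hq
  obtain ⟨B, hB⟩ := hl.bddAbove_range
  have hB' : ∀ k, ‖z k - q‖ ≤ B := fun k => hB ⟨k, rfl⟩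
  have hBe : ∀ k, e k ≤ ∑' i, e i := fun k => he.le_tsum k fun i _ => he0 i
  -- The weighted residuals are summable.
  set C := 2 * B + ∑' i, e i
  have htel : ∀ N, ∑ k ∈ Finset.range N, μ k * (1 - μ k) * ‖z k - R (z k)‖ ^ 2 ≤
      ‖z 0 - q‖ ^ 2 - ‖z N - q‖ ^ 2 + C * ∑ k ∈ Finset.range N, e k := by
    intro N
    induction N with
    | zero => simp
    | succ N ih =>
      rw [Finset.sum_range_succ, Finset.sum_range_succ, mul_add]
      have h1 := hsq q hq N
      have h2 := hdist q N
      have h3 := hstep q hq N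
      set b := ‖(1 - μ N) • z N + μ N • R (z N) - q‖
      have h4 : ‖z (N + 1) - q‖ ^ 2 ≤ (b + e N) ^ 2 := by gcongr
      have h5 : b ≤ B := h3.trans (hB' N)
      have h6 : (b + e N) ^ 2 ≤ b ^ 2 + C * e N := by
        have : 2 * b + e N ≤ C := by
          have := hBe N
          simp only [C]
          linarith
        nlinarith [he0 N]
      linarith
  have hfreq : ∀ δ : ℝ, 0 < δ → ∃ᶠ k in atTop, ‖z k - R (z k)‖ < δ := by
    intro δ hδ hev
    have hev' : ∀ᶠ k in atTop, δ ≤ ‖z k - R (z k)‖ := hev.mono fun k hk => not_lt.1 hk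
    obtain ⟨K, hK⟩ := eventually_atTop.1 hev'
    have hle : ∀ N, δ ^ 2 * ∑ k ∈ Finset.range N, μ k * (1 - μ k) ≤
        ‖z 0 - q‖ ^ 2 + C * ∑' i, e i + δ ^ 2 * ∑ k ∈ Finset.range K, μ k * (1 - μ k) := by
      intro N
      have hw : ∀ k, 0 ≤ μ k * (1 - μ k) := fun k => mul_nonneg (hμ k).1 (sub_nonneg.2 (hμ k).2)
      have hC : 0 ≤ C := by
        have h1 := (norm_nonneg _).trans (hB' 0)
        have h2 := (he0 0).trans (hBe 0)
        positivity
      have h1 : ∀ k ∈ Finset.range N, δ ^ 2 * (μ k * (1 - μ k)) ≤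
          μ k * (1 - μ k) * ‖z k - R (z k)‖ ^ 2 +
            if k < K then δ ^ 2 * (μ k * (1 - μ k)) else 0 := by
        intro k _
        split_ifs with hk
        · have := mul_nonneg (hw k) (sq_nonneg ‖z k - R (z k)‖)
          linarith
        · have h2 := hK k (not_lt.1 hk)
          have h3 : δ ^ 2 ≤ ‖z k - R (z k)‖ ^ 2 := by gcongr
          nlinarith [hw k]
      rw [Finset.mul_sum]
      refine (Finset.sum_le_sum h1).trans ?_
      rw [Finset.sum_add_distrib]
      refine add_le_add ((htel N).trans ?_) ?_
      · have h2 := he.sum_le_tsum (Finset.range N) (fun i _ => he0 i)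
        have h3 := mul_le_mul_of_nonneg_left h2 hC
        nlinarith [sq_nonneg ‖z N - q‖]
      · rw [Finset.mul_sum, ← Finset.sum_filter]
        refine Finset.sum_le_sum_of_subset_of_nonneg (fun k hk => ?_) fun k _ _ =>
          mul_nonneg (sq_nonneg _) (hw k)
        simpa using (Finset.mem_filter.1 hk).2
    have hdiv' := hdiv.const_mul_atTop (sq_pos_of_pos hδ)
    obtain ⟨N, hN⟩ := (hdiv'.eventually_gt_atTop _).exists
    exact absurd (hle N) (not_le.2 hN)
  obtain ⟨φ, hφ, hφr⟩ := extraction_forall_of_frequently fun n : ℕ =>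
    hfreq (1 / ((n : ℝ) + 1)) Nat.one_div_pos_of_nat
  have : ProperSpace E := FiniteDimensional.proper ℝ E
  obtain ⟨p, -, ψ, hψ, hp⟩ := (isCompact_closedBall q B).tendsto_subseq (x := z ∘ φ)
    fun n => by simpa [dist_eq_norm] using hB' (φ n)
  have hRc : Continuous R := (LipschitzWith.of_dist_le_mul (K := 1) fun x y => by
    simpa [dist_eq_norm] using hR x y).continuous
  have hfix : R p = p := by
    have h1 : Tendsto (fun n => ‖(z ∘ φ ∘ ψ) n - R ((z ∘ φ ∘ ψ) n)‖) atTop (𝓝 ‖p - R p‖) :=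
      (hp.sub ((hRc.tendsto p).comp hp)).norm
    have h2 : Tendsto (fun n => ‖(z ∘ φ ∘ ψ) n - R ((z ∘ φ ∘ ψ) n)‖) atTop (𝓝 0) :=
      squeeze_zero (fun _ => norm_nonneg _) (fun n => (hφr (ψ n)).le)
        (tendsto_one_div_add_atTop_nhds_zero_nat.comp hψ.tendsto_atTop)
    exact (sub_eq_zero.1 (norm_eq_zero.1 (tendsto_nhds_unique h1 h2))).symm
  obtain ⟨l', hl'⟩ := hconv p hfix
  have hl0 : l' = 0 := tendsto_nhds_unique
    (hl'.comp (hφ.comp hψ).tendsto_atTop) (by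
      simpa [Function.comp_def] using (hp.sub_const p).norm)
  exact ⟨p, hfix, tendsto_iff_norm_sub_tendsto_zero.2 (hl0 ▸ hl')⟩

end KrasnoselskiiMann

/-! ### Convergence of the Douglas–Rachford iteration -/

section DouglasRachford

/-- Convergence of the step sizes forces their limit to be `γ`. -/
theorem tendsto_step_size {lam γs : ℕ → ℝ} {γ : ℝ} (hlam : ∀ k, lam k ∈ Set.Icc (0 : ℝ) 2)
    (hlam_sum : Tendsto (fun N => ∑ k ∈ Finset.range N, lam k * (2 - lam k)) atTop atTop)
    (hγ_sum : Summable (fun k => lam k * |γs k - γ|))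
    (hγ_conv : ∃ l : ℝ, Tendsto γs atTop (𝓝 l)) : Tendsto γs atTop (𝓝 γ) := by
  obtain ⟨l, hl⟩ := hγ_conv
  by_contra hcon
  have hne : l ≠ γ := fun h => hcon (h ▸ hl)
  have hpos : 0 < |l - γ| := abs_pos.2 (sub_ne_zero.2 hne)
  have hev : ∀ᶠ k in atTop, |l - γ| / 2 < |γs k - γ| :=
    ((hl.sub_const γ).abs).eventually_const_lt (half_lt_self hpos)
  have hs : Summable fun k => lam k * (2 - lam k) := by
    refine Summable.of_norm_bounded_eventually_nat
      (g := fun k => 4 / |l - γ| * (lam k * |γs k - γ|)) (hγ_sum.mul_left _) ?_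
    filter_upwards [hev] with k hk
    obtain ⟨h0, h2⟩ := hlam k
    rw [Real.norm_of_nonneg (mul_nonneg h0 (sub_nonneg.2 h2)), div_mul_eq_mul_div,
      le_div_iff₀ hpos]
    nlinarith [mul_nonneg h0 hpos.le, mul_nonneg h0 h0, mul_le_mul_of_nonneg_left hk.le h0,
      mul_nonneg (mul_nonneg h0 h0) hpos.le]
  exact not_tendsto_nhds_of_tendsto_atTop hlam_sum _ hs.hasSum.tendsto_sum_nat

variable {E : Type*} [NormedAddCommGroup E] [InnerProductSpace ℝ E] [FiniteDimensional ℝ E]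
  {G J : E → EReal} {γ γ' : ℝ}

theorem rprox_rprox_eq_of_subgradients (hG : IsGammaZero G) (hJ : IsGammaZero J) (hγ : 0 < γ)
    {x u : E} (hu : u ∈ subdifferential G x) (hu' : -u ∈ subdifferential J x) :
    rprox γ G (rprox γ J (x - γ • u)) = x - γ • u := by
  have hJx : prox γ J (x - γ • u) = x := hJ.prox_eq_of_subgradient hγ (by
    convert hu' using 1
    rw [sub_sub_cancel_left, smul_neg, smul_smul, inv_mul_cancel₀ hγ.ne', one_smul])
  have h1 : rprox γ J (x - γ • u) = x + γ • u := by
    rw [rprox, hJx]; module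
  have hGx : prox γ G (x + γ • u) = x := hG.prox_eq_of_subgradient hγ (by
    convert hu using 1
    rw [add_sub_cancel_left, smul_smul, inv_mul_cancel₀ hγ.ne', one_smul])
  rw [h1, rprox, hGx]; module

omit [FiniteDimensional ℝ E] in
theorem prox_eq_of_rprox_rprox_eq {z : E} (h : rprox γ G (rprox γ J z) = z) :
    prox γ G ((2 : ℝ) • prox γ J z - z) = prox γ J z := by
  rw [rprox, rprox] at h
  have h1 : (2 : ℝ) • (prox γ G ((2 : ℝ) • prox γ J z - z) - prox γ J z) = 0 := by
    rw [← sub_eq_zero.2 h]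
    module
  exact sub_eq_zero.1 ((smul_eq_zero.1 h1).resolve_left two_ne_zero)

theorem norm_rprox_rprox_sub_le_of_step (hG : IsGammaZero G) (hJ : IsGammaZero J) (hγ : 0 < γ)
    (hγ' : 0 < γ') (z : E) :
    ‖rprox γ' G (rprox γ' J z) - rprox γ G (rprox γ J z)‖ ≤
      |γ' - γ| / γ * (‖z - rprox γ J z‖ + ‖rprox γ J z - rprox γ G (rprox γ J z)‖) := by
  have h1 := hG.norm_rprox_sub_rprox_le hγ' (rprox γ' J z) (rprox γ J z)
  have h2 := hJ.norm_rprox_sub_rprox_le_of_step hγ hγ' z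
  have h3 := hG.norm_rprox_sub_rprox_le_of_step hγ hγ' (rprox γ J z)
  have h4 := norm_sub_le_norm_sub_add_norm_sub (rprox γ' G (rprox γ' J z))
    (rprox γ' G (rprox γ J z)) (rprox γ G (rprox γ J z))
  rw [mul_add]
  linarith

/-- The nonstationary Douglas–Rachford sequence converges to a fixed point: it is an inexact
Krasnoselskii–Mann iteration of the stationary operator whose errors, of size
`λ_k |γ_k - γ|` times at most a linear function of `‖z_k‖`, are summable. -/
theorem IsNonstationaryDR.exists_tendsto (hG : IsGammaZero G) (hJ : IsGammaZero J)
    {lam γs : ℕ → ℝ} (hlam : ∀ k, lam k ∈ Set.Icc (0 : ℝ) 2)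
    (hlam_sum : Tendsto (fun N => ∑ k ∈ Finset.range N, lam k * (2 - lam k)) atTop atTop)
    (hγs : ∀ k, 0 < γs k) (hγ : 0 < γ) (hγ_sum : Summable (fun k => lam k * |γs k - γ|))
    {z x v : ℕ → E} (hDR : IsNonstationaryDR G J γs lam z x v) {q : E}
    (hq : rprox γ G (rprox γ J q) = q) :
    ∃ zs, rprox γ G (rprox γ J zs) = zs ∧ Tendsto z atTop (𝓝 zs) := by
  set R : E → E := fun z => rprox γ G (rprox γ J z) with hRdef
  have hR : ∀ x y, ‖R x - R y‖ ≤ ‖x - y‖ := fun x y =>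
    (hG.norm_rprox_sub_rprox_le hγ _ _).trans (hJ.norm_rprox_sub_rprox_le hγ _ _)
  set μ : ℕ → ℝ := fun k => lam k / 2 with hμdef
  have hμ : ∀ k, μ k ∈ Set.Icc (0 : ℝ) 1 := fun k =>
    ⟨by simp only [μ]; linarith [(hlam k).1], by simp only [μ]; linarith [(hlam k).2]⟩
  have hx : ∀ k, x k = prox (γs k) J (z k) := fun k => by
    cases k with
    | zero => exact hDR.x_zero
    | succ k => exact hDR.x_succ k
  have hz : ∀ k, z (k + 1) =
      (1 - μ k) • z k + μ k • rprox (γs k) G (rprox (γs k) J (z k)) := by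
    intro k
    have h1 : rprox (γs k) J (z k) = (2 : ℝ) • x k - z k := by rw [rprox, hx]
    rw [hDR.z_succ, h1, rprox, ← hDR.v_succ]
    simp only [hμdef]
    module
  set B := ‖q - rprox γ J q‖ + ‖rprox γ J q - R q‖ with hB
  have herr : ∀ k, ‖z (k + 1) - ((1 - μ k) • z k + μ k • R (z k))‖ ≤
      (4 + B) / (2 * γ) * (lam k * |γs k - γ|) * (1 + ‖z k - q‖) := by
    intro k
    have h1 : z (k + 1) - ((1 - μ k) • z k + μ k • R (z k)) =
        μ k • (rprox (γs k) G (rprox (γs k) J (z k)) - R (z k)) := by rw [hz k]; module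
    rw [h1, norm_smul, Real.norm_of_nonneg (hμ k).1]
    have h2 := norm_rprox_rprox_sub_le_of_step hG hJ hγ (hγs k) (z k)
    have h3 : ‖z k - rprox γ J (z k)‖ ≤ 2 * ‖z k - q‖ + ‖q - rprox γ J q‖ := by
      have h4 : z k - rprox γ J (z k) =
          (z k - q) - (rprox γ J (z k) - rprox γ J q) + (q - rprox γ J q) := by abel
      have h5 := hJ.norm_rprox_sub_rprox_le hγ (z k) q
      rw [h4]
      refine (norm_add_le _ _).trans ?_
      have := norm_sub_le (z k - q) (rprox γ J (z k) - rprox γ J q)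
      linarith
    have h3' : ‖rprox γ J (z k) - R (z k)‖ ≤ 2 * ‖z k - q‖ + ‖rprox γ J q - R q‖ := by
      have h4 : rprox γ J (z k) - R (z k) =
          (rprox γ J (z k) - rprox γ J q) - (R (z k) - R q) + (rprox γ J q - R q) := by abel
      have h5 := hJ.norm_rprox_sub_rprox_le hγ (z k) q
      have h6 := hR (z k) q
      rw [h4]
      refine (norm_add_le _ _).trans ?_
      have := norm_sub_le (rprox γ J (z k) - rprox γ J q) (R (z k) - R q)
      linarith
    have hB0 : 0 ≤ B := by positivity
    have h7 : ‖z k - rprox γ J (z k)‖ + ‖rprox γ J (z k) - R (z k)‖ ≤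
        (4 + B) * (1 + ‖z k - q‖) := by
      nlinarith [norm_nonneg (z k - q)]
    calc μ k * ‖rprox (γs k) G (rprox (γs k) J (z k)) - R (z k)‖
        ≤ μ k * (|γs k - γ| / γ * ((4 + B) * (1 + ‖z k - q‖))) := by
          refine mul_le_mul_of_nonneg_left (h2.trans ?_) (hμ k).1
          exact mul_le_mul_of_nonneg_left h7 (by positivity)
      _ = _ := by
        simp only [hμdef]
        field_simp
  set ε : ℕ → ℝ := fun k => (4 + B) / (2 * γ) * (lam k * |γs k - γ|) with hεdef
  have hε0 : ∀ k, 0 ≤ ε k := fun k => by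
    have := (hlam k).1
    have hB0 : 0 ≤ B := by positivity
    positivity
  have hεs : Summable ε := hγ_sum.mul_left _
  obtain ⟨C, hC⟩ := exists_bound_of_le_one_add_mul (A := fun k => 1 + ‖z k - q‖) hε0 hεs
    (fun k => by positivity) (fun k => by
      have h1 := norm_sub_le_norm_sub_add_norm_sub (z (k + 1))
        ((1 - μ k) • z k + μ k • R (z k)) q
      have h2 : ‖(1 - μ k) • z k + μ k • R (z k) - q‖ ≤ ‖z k - q‖ := by
        have h3 : (1 - μ k) • z k + μ k • R (z k) - q =
            (1 - μ k) • (z k - q) + μ k • (R (z k) - R q) := by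
          rw [show R q = q from hq]; module
        rw [h3]
        refine (norm_add_le _ _).trans ?_
        rw [norm_smul, norm_smul, Real.norm_of_nonneg (hμ k).1,
          Real.norm_of_nonneg (sub_nonneg.2 (hμ k).2)]
        have := mul_le_mul_of_nonneg_left (hR (z k) q) (hμ k).1
        linarith
      have h4 := herr k
      linarith)
  have hdiv : Tendsto (fun N => ∑ k ∈ Finset.range N, μ k * (1 - μ k)) atTop atTop := by
    refine (hlam_sum.const_mul_atTop (r := 1 / 4) (by norm_num)).congr fun N => ?_
    rw [Finset.mul_sum]
    refine Finset.sum_congr rfl fun k _ => ?_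
    simp only [hμdef]
    ring
  exact krasnoselskii_mann_tendsto hR hq hμ hdiv (hεs.mul_right C) fun k =>
    (herr k).trans (mul_le_mul_of_nonneg_left (hC k) (hε0 k))

end DouglasRachford

/-! ### Identification of the partial smoothness manifold -/

section Identification

variable {E : Type*} [NormedAddCommGroup E] [InnerProductSpace ℝ E] {F : E → EReal} {M : Set E}
  {x : E}

theorem IsCurveThrough.tendsto {c : ℝ → E} {h : E} (hc : IsCurveThrough M x c h) :
    Tendsto c (𝓝 0) (𝓝 x) := by
  have := hc.2.2.continuousAt.tendsto
  rwa [hc.1] at this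

theorem IsCurveThrough.tendsto_nhdsWithin {c : ℝ → E} {h : E} (hc : IsCurveThrough M x c h) :
    Tendsto c (𝓝 0) (𝓝[M] x) :=
  tendsto_nhdsWithin_iff.2 ⟨hc.tendsto, hc.2.1⟩

variable [FiniteDimensional ℝ E]

/-- Sliding along the normal space at `x` is a local retraction onto the manifold: every point near
`x` differs by a vector normal at `x` from some point of the manifold near `x`. -/
theorem IsC2ManifoldAround.exists_normal_retraction (hM : IsC2ManifoldAround M x) :
    ∃ ψ : E → E, Tendsto ψ (𝓝 x) (𝓝 x) ∧
      ∀ᶠ y in 𝓝 x, ψ y ∈ M ∧ y - ψ y ∈ (tangentSpace M x)ᗮ := by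
  obtain ⟨hx, m, Φ, hΦ, hsurj, hev⟩ := hM
  have hΦx : Φ x = 0 := hev.self_of_nhds.1 hx
  have hstrict : HasStrictFDerivAt Φ (fderiv ℝ Φ x) x := hΦ.hasStrictFDerivAt (by norm_num)
  set f' := fderiv ℝ Φ x
  set T : Submodule ℝ E := f'.ker with hT
  have htan : tangentSpace M x ≤ T := by
    refine Submodule.span_le.2 ?_
    rintro h ⟨c, hc⟩
    have h1 : HasDerivAt (fun t => Φ (c t)) (f' h) 0 := by
      have h2 : HasFDerivAt Φ f' (c 0) := by rw [hc.1]; exact hstrict.hasFDerivAt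
      exact h2.comp_hasDerivAt (0 : ℝ) hc.2.2
    have h2 : (fun t => Φ (c t)) =ᶠ[𝓝 0] fun _ => 0 := by
      filter_upwards [hc.tendsto.eventually hev, hc.2.1] with t ht htM using ht.1 htM
    exact h1.unique ((hasDerivAt_const (0 : ℝ) (0 : EuclideanSpace ℝ (Fin m))).congr_of_eventuallyEq
      h2)
  let φ : ImplicitFunctionData ℝ E (EuclideanSpace ℝ (Fin m)) T :=
    { leftFun := Φ
      leftDeriv := f'
      rightFun := T.orthogonalProjectionOnto
      rightDeriv := T.orthogonalProjectionOnto
      pt := x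
      hasStrictFDerivAt_leftFun := hstrict
      hasStrictFDerivAt_rightFun := T.orthogonalProjectionOnto.hasStrictFDerivAt
      range_leftDeriv := LinearMap.range_eq_top.2 hsurj
      range_rightDeriv := LinearMap.range_eq_top.2 fun v =>
        ⟨v, Submodule.orthogonalProjectionOnto_mem_subspace_eq_self v⟩
      isCompl_ker := by
        rw [Submodule.ker_orthogonalProjectionOnto]
        exact Submodule.isCompl_orthogonal _ }
  set ψ : E → E := fun y => φ.implicitFunction (Φ x) (T.orthogonalProjectionOnto y) with hψ
  have hψx : ψ x = x := φ.implicitFunction_apply_image.self_of_nhds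
  have hψt : Tendsto ψ (𝓝 x) (𝓝 x) := by
    have h1 : ContinuousAt (φ.implicitFunction (Φ x)) (T.orthogonalProjectionOnto x) :=
      φ.differentiableAt_implicitFunction.continuousAt
    have h2 : ContinuousAt ψ x :=
      ContinuousAt.comp (f := T.orthogonalProjectionOnto) h1
        T.orthogonalProjectionOnto.continuous.continuousAt
    have h3 := h2.tendsto
    rwa [hψx] at h3
  refine ⟨ψ, hψt, ?_⟩
  filter_upwards [hψt.eventually hev, φ.leftFun_implicitFunction_eq_leftFun,
    φ.rightFun_implicitFunction_eq_rightFun] with y h1 h2 h3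
  refine ⟨h1.2 (h2.trans hΦx), Submodule.orthogonal_le htan ?_⟩
  have h3' : T.orthogonalProjectionOnto (ψ y) = T.orthogonalProjectionOnto y := h3
  rw [← Submodule.orthogonalProjectionOnto_eq_zero_iff, map_sub, h3', sub_self]

theorem IsPartlySmooth.orthogonal_tangentSpace (h : IsPartlySmooth F M x) :
    (tangentSpace M x)ᗮ = vectorSpan ℝ (subdifferential F x) := by
  rw [h.sharp, sharpSubspace, Submodule.orthogonal_orthogonal]

/-- If `(y, u)` in the graph of `∂F` is close to `(x, ū)` with `ū` in the relative interior of
`∂F x`, then `y` lies in the partial smoothness manifold. Otherwise the unit normal directions from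
the manifold to `y` accumulate at some `n` parallel to `∂F x`; then `ū + ε n` is a subgradient at
`x`, hence a limit of subgradients at points of the manifold, and this contradicts the monotonicity
of `∂F`. -/
theorem IsPartlySmooth.eventually_mem (h : IsPartlySmooth F M x) {ubar : E}
    (hu : ubar ∈ intrinsicInterior ℝ (subdifferential F x)) :
    ∀ᶠ p : E × E in 𝓝 (x, ubar), p.2 ∈ subdifferential F p.1 → p.1 ∈ M := by
  obtain ⟨ψ, hψ, hψM⟩ := h.manifold.exists_normal_retraction
  rw [h.orthogonal_tangentSpace] at hψM
  by_contra hcon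
  rw [not_eventually] at hcon
  have hne : NeBot (𝓝 (x, ubar) ⊓ 𝓟 {p : E × E | ¬(p.2 ∈ subdifferential F p.1 → p.1 ∈ M)}) :=
    frequently_iff_neBot.1 hcon
  set 𝒰 := Ultrafilter.of (𝓝 (x, ubar) ⊓ 𝓟 {p : E × E | ¬(p.2 ∈ subdifferential F p.1 → p.1 ∈ M)})
  have hle := Ultrafilter.of_le
    (𝓝 (x, ubar) ⊓ 𝓟 {p : E × E | ¬(p.2 ∈ subdifferential F p.1 → p.1 ∈ M)})
  have hbad : ∀ᶠ p : E × E in (𝒰 : Filter (E × E)), p.2 ∈ subdifferential F p.1 ∧ p.1 ∉ M := by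
    have : ∀ᶠ p : E × E in (𝒰 : Filter (E × E)), ¬(p.2 ∈ subdifferential F p.1 → p.1 ∈ M) :=
      le_principal_iff.1 (hle.trans inf_le_right)
    filter_upwards [this] with p hp
    push Not at hp
    exact hp
  have hlim : Tendsto id (𝒰 : Filter (E × E)) (𝓝 (x, ubar)) := hle.trans inf_le_left
  have h1 : Tendsto (fun p : E × E => p.1) (𝒰 : Filter (E × E)) (𝓝 x) :=
    (continuous_fst.tendsto (x, ubar)).comp hlim
  have h2 : Tendsto (fun p : E × E => p.2) (𝒰 : Filter (E × E)) (𝓝 ubar) :=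
    (continuous_snd.tendsto (x, ubar)).comp hlim
  have hψU := h1.eventually hψM
  have hψlim : Tendsto (fun p : E × E => ψ p.1) (𝒰 : Filter (E × E)) (𝓝[M] x) :=
    tendsto_nhdsWithin_iff.2 ⟨hψ.comp h1, hψU.mono fun p hp => hp.1⟩
  -- the unit normal directions and their limit
  set ν : E × E → E := fun p => ‖p.1 - ψ p.1‖⁻¹ • (p.1 - ψ p.1) with hν
  have hpos : ∀ᶠ p : E × E in (𝒰 : Filter (E × E)), 0 < ‖p.1 - ψ p.1‖ := by
    filter_upwards [hbad, hψU] with p hp hp'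
    refine norm_pos_iff.2 fun h0 => hp.2 ?_
    rw [sub_eq_zero.1 h0]
    exact hp'.1
  have hν1 : ∀ᶠ p : E × E in (𝒰 : Filter (E × E)), ν p ∈ Metric.sphere (0 : E) 1 := by
    filter_upwards [hpos] with p hp
    simp [hν, norm_smul, hp.ne']
  have : ProperSpace E := FiniteDimensional.proper ℝ E
  obtain ⟨n, hn1, hn⟩ := (isCompact_sphere (0 : E) 1).ultrafilter_le_nhds (𝒰.map ν)
    (le_principal_iff.2 hν1)
  have hνn : Tendsto ν (𝒰 : Filter (E × E)) (𝓝 n) := hn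
  have hnnorm : ‖n‖ = 1 := by simpa using hn1
  have hnN : n ∈ vectorSpan ℝ (subdifferential F x) :=
    (Submodule.closed_of_finiteDimensional _).mem_of_tendsto hνn
      (hψU.mono fun p hp => Submodule.smul_mem _ _ hp.2)
  obtain ⟨ε, hε, hseg⟩ := exists_segment_of_mem_intrinsicInterior hu hnN
  have hw := hψlim.eventually (h.continuity.inner _ (hseg ε (abs_of_pos hε).le) _
    (Metric.ball_mem_nhds _ (by positivity : 0 < ε / 4)))
  obtain ⟨p, hp, hpp, ⟨w, hwF, hwb⟩, hp2, hνp, hν1p⟩ := (hbad.and (hpos.and (hw.and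
    ((h2.eventually (Metric.ball_mem_nhds _ (by positivity : 0 < ε / 4))).and
      ((hνn.eventually (Metric.ball_mem_nhds _ (by norm_num : (0 : ℝ) < 1 / 4))).and hν1))))).exists
  rw [dist_eq_norm] at hp2 hνp
  rw [Metric.mem_ball, dist_eq_norm] at hwb
  have hν1p' : ‖ν p‖ = 1 := by simpa using hν1p
  have hmono : 0 ≤ ⟪p.2 - w, ν p⟫_ℝ := by
    simp only [hν, inner_smul_right]
    exact mul_nonneg (by positivity) (h.gammaZero.subdifferential_monotone hp.1 hwF)
  have hsplit : p.2 - w = (p.2 - ubar) - (w - (ubar + ε • n)) - ε • n := by abel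
  rw [hsplit, inner_sub_left, inner_sub_left, real_inner_smul_left] at hmono
  have e1 := real_inner_le_norm (p.2 - ubar) (ν p)
  have e2 := (abs_le.1 (abs_real_inner_le_norm (w - (ubar + ε • n)) (ν p))).1
  have e3 : 3 / 4 ≤ ⟪n, ν p⟫_ℝ := by
    have e4 := (abs_le.1 (abs_real_inner_le_norm n (ν p - n))).1
    rw [inner_sub_right, real_inner_self_eq_norm_sq, hnnorm] at e4
    linarith
  rw [hν1p'] at e1 e2
  nlinarith

omit [FiniteDimensional ℝ E] in
/-- A subgradient reproduces the derivative of `F` along curves in a set on which `F` is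
differentiable. -/
theorem inner_eq_fderiv_of_mem_subdifferential {f : E → ℝ} (hf : DifferentiableAt ℝ f x)
    (hFf : ∀ᶠ y in 𝓝[M] x, F y = f y) {c : ℝ → E} {h g : E} (hc : IsCurveThrough M x c h)
    (hg : g ∈ subdifferential F x) : ⟪g, h⟫_ℝ = fderiv ℝ f x h := by
  have hev := hc.tendsto_nhdsWithin.eventually hFf
  have hx : F x = f x := by
    have := hev.self_of_nhds
    rwa [hc.1] at this
  have hd : HasDerivAt (fun t => f (c t) - ⟪g, c t⟫_ℝ) (fderiv ℝ f x h - ⟪g, h⟫_ℝ) 0 := by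
    have h1 : HasFDerivAt f (fderiv ℝ f x) (c 0) := by rw [hc.1]; exact hf.hasFDerivAt
    exact (h1.comp_hasDerivAt (0 : ℝ) hc.2.2).sub
      ((innerSL ℝ g).hasFDerivAt.comp_hasDerivAt (0 : ℝ) hc.2.2)
  have hmin : IsLocalMin (fun t => f (c t) - ⟪g, c t⟫_ℝ) 0 := by
    filter_upwards [hev] with t ht
    have h1 := (mem_subdifferential_iff hx).1 hg _ (mem_epi_of_eq ht)
    simp only [inner_sub_right] at h1
    rw [hc.1]
    linarith
  have := hmin.hasDerivAt_eq_zero hd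
  linarith

/-- The subdifferential cannot become thinner at nearby points of the manifold: by inner
semicontinuity its affine hull keeps spanning the directions parallel to `∂F x`. -/
theorem IsPartlySmooth.eventually_sharpSubspace_inf_orthogonal (h : IsPartlySmooth F M x) :
    ∀ᶠ y in 𝓝[M] x, (sharpSubspace F x)ᗮ ⊓ sharpSubspace F y = ⊥ := by
  by_contra hcon
  rw [not_eventually] at hcon
  have hunit : ∀ y, ¬((sharpSubspace F x)ᗮ ⊓ sharpSubspace F y = ⊥) →
      ∃ n, ‖n‖ = 1 ∧ n ∈ (sharpSubspace F x)ᗮ ∧ n ∈ sharpSubspace F y := by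
    intro y hy
    obtain ⟨n, hn, hn0⟩ := Submodule.exists_mem_ne_zero_of_ne_bot hy
    have := norm_pos_iff.2 hn0
    exact ⟨‖n‖⁻¹ • n, by simp [norm_smul, this.ne'], Submodule.smul_mem _ _ hn.1,
      Submodule.smul_mem _ _ hn.2⟩
  choose! ν hν using hunit
  have hne : NeBot (𝓝[M] x ⊓ 𝓟 {y | ¬((sharpSubspace F x)ᗮ ⊓ sharpSubspace F y = ⊥)}) :=
    frequently_iff_neBot.1 hcon
  set 𝒰 := Ultrafilter.of (𝓝[M] x ⊓ 𝓟 {y | ¬((sharpSubspace F x)ᗮ ⊓ sharpSubspace F y = ⊥)})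
  have hle := Ultrafilter.of_le
    (𝓝[M] x ⊓ 𝓟 {y | ¬((sharpSubspace F x)ᗮ ⊓ sharpSubspace F y = ⊥)})
  have hbad : ∀ᶠ y in (𝒰 : Filter E), ‖ν y‖ = 1 ∧ ν y ∈ (sharpSubspace F x)ᗮ ∧
      ν y ∈ sharpSubspace F y := by
    have : ∀ᶠ y in (𝒰 : Filter E), ¬((sharpSubspace F x)ᗮ ⊓ sharpSubspace F y = ⊥) :=
      le_principal_iff.1 (hle.trans inf_le_right)
    exact this.mono hν
  have hlim : (𝒰 : Filter E) ≤ 𝓝[M] x := hle.trans inf_le_left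
  have : ProperSpace E := FiniteDimensional.proper ℝ E
  obtain ⟨n, hn1, hn⟩ := (isCompact_sphere (0 : E) 1).ultrafilter_le_nhds (𝒰.map ν)
    (le_principal_iff.2 (hbad.mono fun y hy => by simpa using hy.1))
  have hνn : Tendsto ν (𝒰 : Filter E) (𝓝 n) := hn
  have hnnorm : ‖n‖ = 1 := by simpa using hn1
  have hnT : n ∈ (sharpSubspace F x)ᗮ :=
    (Submodule.closed_of_finiteDimensional _).mem_of_tendsto hνn (hbad.mono fun y hy => hy.2.1)
  have hzero : ∀ u ∈ subdifferential F x, ∀ u' ∈ subdifferential F x, ⟪u - u', n⟫_ℝ = 0 := by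
    intro u hu u' hu'
    by_contra h0
    have hδ : 0 < |⟪u - u', n⟫_ℝ| / 4 := by positivity
    set δ := |⟪u - u', n⟫_ℝ| / 4
    have e1 := hlim (h.continuity.inner u hu _ (Metric.ball_mem_nhds u hδ))
    have e2 := hlim (h.continuity.inner u' hu' _ (Metric.ball_mem_nhds u' hδ))
    have e3 : Tendsto (fun y => |⟪u - u', ν y⟫_ℝ|) (𝒰 : Filter E) (𝓝 |⟪u - u', n⟫_ℝ|) :=
      (tendsto_const_nhds.inner hνn).abs
    have e4 : ∀ᶠ y in (𝒰 : Filter E), |⟪u - u', ν y⟫_ℝ| ≤ 2 * δ := by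
      filter_upwards [e1, e2, hbad] with y hy hy' hν'
      obtain ⟨w, hw, hwb⟩ := hy
      obtain ⟨w', hw', hwb'⟩ := hy'
      rw [Metric.mem_ball, dist_eq_norm] at hwb hwb'
      have e5 : ⟪w - w', ν y⟫_ℝ = 0 :=
        Submodule.inner_right_of_mem_orthogonal (vsub_mem_vectorSpan ℝ hw hw') hν'.2.2
      have e6 : u - u' = (w - w') - ((w - u) - (w' - u')) := by abel
      rw [e6, inner_sub_left, e5, zero_sub, abs_neg]
      refine (abs_real_inner_le_norm _ _).trans ?_
      rw [hν'.1, mul_one]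
      refine (norm_sub_le _ _).trans ?_
      linarith
    have e7 := le_of_tendsto e3 e4
    simp only [δ] at e7 hδ
    linarith
  have hnT' : n ∈ sharpSubspace F x := by
    rw [sharpSubspace, Submodule.mem_orthogonal]
    intro d hd
    rw [vectorSpan_def] at hd
    induction hd using Submodule.span_induction with
    | mem d hd =>
      obtain ⟨u, hu, u', hu', rfl⟩ := hd
      exact hzero u hu u' hu'
    | zero => exact inner_zero_left _
    | add a b _ _ ha hb => rw [inner_add_left, ha, hb, add_zero]
    | smul r a _ ha => rw [inner_smul_left, ha, mul_zero]
  have hnn : ⟪n, n⟫_ℝ = 0 := Submodule.inner_right_of_mem_orthogonal hnT' hnT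
  rw [real_inner_self_eq_norm_sq, hnnorm] at hnn
  norm_num at hnn

/-- Where `M` coincides with an affine subspace, its tangent space is the direction. -/
theorem tangentSpace_eq_of_eventually_affine {T : Submodule ℝ E} {x₀ : E} (hx : x ∈ M)
    (hM : ∀ᶠ y in 𝓝 x, (y ∈ M ↔ y - x₀ ∈ T)) : tangentSpace M x = T := by
  have hxT : x - x₀ ∈ T := hM.self_of_nhds.1 hx
  apply le_antisymm
  · refine Submodule.span_le.2 ?_
    rintro h ⟨c, hc⟩
    have hev : ∀ᶠ t in 𝓝 (0 : ℝ), c t - x₀ ∈ T := by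
      filter_upwards [hc.tendsto.eventually hM, hc.2.1] with t ht htM using ht.1 htM
    rw [SetLike.mem_coe, ← Submodule.orthogonal_orthogonal T, Submodule.mem_orthogonal]
    intro n hn
    have h1 : HasDerivAt (fun t => ⟪n, c t - x₀⟫_ℝ) ⟪n, h⟫_ℝ 0 :=
      (innerSL ℝ n).hasFDerivAt.comp_hasDerivAt (0 : ℝ) (hc.2.2.sub_const x₀)
    have h2 : (fun t => ⟪n, c t - x₀⟫_ℝ) =ᶠ[𝓝 0] fun _ => 0 := by
      filter_upwards [hev] with t ht using Submodule.inner_left_of_mem_orthogonal ht hn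
    exact h1.unique ((hasDerivAt_const (0 : ℝ) (0 : ℝ)).congr_of_eventuallyEq h2)
  · intro h hh
    refine Submodule.subset_span ⟨fun t => x + t • h, by simp, ?_, ?_⟩
    · have hc : Tendsto (fun t : ℝ => x + t • h) (𝓝 0) (𝓝 x) := by
        have : Continuous fun t : ℝ => x + t • h := by fun_prop
        simpa using this.tendsto 0
      filter_upwards [hc.eventually hM] with t ht
      refine ht.2 ?_
      rw [add_sub_right_comm]
      exact T.add_mem hxT (T.smul_mem _ hh)
    · simpa using ((hasDerivAt_id (0 : ℝ)).smul_const h).const_add x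

/-- If the manifold is affine near `x`, the tangent spaces and the subspaces `T_y` agree with `T_x`
at all nearby points of the manifold. -/
theorem IsPartlySmooth.eventually_sharpSubspace_eq (h : IsPartlySmooth F M x)
    (hM : ∀ᶠ y in 𝓝 x, (y ∈ M ↔ y - x ∈ sharpSubspace F x)) :
    ∀ᶠ y in 𝓝 x, y ∈ M →
      sharpSubspace F y = sharpSubspace F x ∧ tangentSpace M y = sharpSubspace F x := by
  obtain ⟨f, hf, hFf⟩ := h.smooth
  have hf' : ∀ᶠ y in 𝓝 x, ContDiffAt ℝ 2 f y := hf.eventually (by norm_num)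
  have hFf' : ∀ᶠ y in 𝓝 x, ∀ᶠ y' in 𝓝[M] y, F y' = f y' := by
    filter_upwards [(eventually_nhdsWithin_iff.1 hFf).eventually_nhds] with y hy
    exact eventually_nhdsWithin_iff.2 hy
  filter_upwards [hM.eventually_nhds, hf', hFf',
    eventually_nhdsWithin_iff.1 h.eventually_sharpSubspace_inf_orthogonal] with y h1 h2 h3 h4 hy
  have htan := tangentSpace_eq_of_eventually_affine hy h1
  refine ⟨?_, htan⟩
  have hle : sharpSubspace F x ≤ sharpSubspace F y := by
    rw [← htan, tangentSpace, Submodule.span_le]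
    rintro d ⟨c, hc⟩
    rw [SetLike.mem_coe, sharpSubspace, Submodule.mem_orthogonal]
    intro g hg
    rw [vectorSpan_def] at hg
    induction hg using Submodule.span_induction with
    | mem g hg =>
      obtain ⟨u, hu, u', hu', rfl⟩ := hg
      have hdiff := h2.differentiableAt (by norm_num)
      change ⟪u - u', d⟫_ℝ = 0
      rw [inner_sub_left, inner_eq_fderiv_of_mem_subdifferential hdiff h3 hc hu,
        inner_eq_fderiv_of_mem_subdifferential hdiff h3 hc hu', sub_self]
    | zero => exact inner_zero_left _
    | add a b _ _ ha hb => rw [inner_add_left, ha, hb, add_zero]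
    | smul r a _ ha => rw [inner_smul_left, ha, mul_zero]
  have := Submodule.sup_orthogonal_inf_of_hasOrthogonalProjection hle
  rw [h4 hy, sup_bot_eq] at this
  exact this.symm

end Identification

/-! ### Locally polyhedral functions -/

section Polyhedral

variable {E : Type*} [NormedAddCommGroup E] [InnerProductSpace ℝ E] [FiniteDimensional ℝ E]
  {F : E → EReal} {M : Set E} {x : E} {a : ℝ}

/-- The epigraph of a locally polyhedral function is a cone near its vertex `(x, F x)`; only the
dilation by the factor `2` is needed. -/
theorem IsLocallyPolyhedralAt.eventually_epi_dilation (hF : IsLocallyPolyhedralAt F x)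
    (hx : F x = a) :
    ∀ᶠ d : E × ℝ in 𝓝 0, (x + d.1, a + d.2) ∈ epi F →
      (x + (2 : ℝ) • d.1, a + 2 * d.2) ∈ epi F := by
  obtain ⟨P, ⟨s, hs⟩, hev⟩ := hF
  have hPx : ((x, a) : E × ℝ) ∈ epi P := by
    have : P x = a := by rw [← hev.self_of_nhds, hx]
    exact mem_epi_of_eq this
  have h0 : ∀ q ∈ s, q.1 (x, a) ≤ q.2 := by rwa [hs] at hPx
  have hq : ∀ q ∈ s, ∀ᶠ d : E × ℝ in 𝓝 0, q.1 ((x, a) + d) ≤ q.2 →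
      q.1 ((x, a) + (2 : ℝ) • d) ≤ q.2 := by
    intro q hqs
    rcases (h0 q hqs).lt_or_eq with h | h
    · have hc : Continuous fun d : E × ℝ => q.1 ((x, a) + (2 : ℝ) • d) :=
        q.1.continuous_of_finiteDimensional.comp (by fun_prop)
      have h1 : Tendsto (fun d : E × ℝ => q.1 ((x, a) + (2 : ℝ) • d)) (𝓝 0) (𝓝 (q.1 (x, a))) := by
        simpa using hc.tendsto 0
      filter_upwards [h1.eventually_lt_const h] with d hd _ using hd.le
    · refine Eventually.of_forall fun d hd => ?_
      rw [map_add, h] at hd ⊢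
      rw [map_smul, smul_eq_mul]
      linarith
  have h1 : Tendsto (fun d : E × ℝ => x + d.1) (𝓝 0) (𝓝 x) := by
    have : Continuous fun d : E × ℝ => x + d.1 := by fun_prop
    simpa using this.tendsto 0
  have h2 : Tendsto (fun d : E × ℝ => x + (2 : ℝ) • d.1) (𝓝 0) (𝓝 x) := by
    have : Continuous fun d : E × ℝ => x + (2 : ℝ) • d.1 := by fun_prop
    simpa using this.tendsto 0
  filter_upwards [(eventually_all_finset s).2 hq, h1.eventually hev, h2.eventually hev]
    with d hd hd1 hd2 hmem
  have hmem' : ((x, a) + d : E × ℝ) ∈ epi P := by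
    change P (x + d.1) ≤ _
    rw [← hd1]
    exact hmem
  rw [hs] at hmem'
  have h3 : ((x, a) + (2 : ℝ) • d : E × ℝ) ∈ epi P := by
    rw [hs]
    exact fun q hqs => hd q hqs (hmem' q hqs)
  change F (x + (2 : ℝ) • d.1) ≤ _
  rw [hd2]
  exact h3

/-- Near `x`, subgradients of a locally polyhedral function that stay bounded are subgradients at
`x` and reproduce the increment of the function. -/
theorem IsLocallyPolyhedralAt.eventually_subdifferential (hP : IsLocallyPolyhedralAt F x)
    (hF : IsGammaZero F) (hx : F x = a) {u : E} (hu : u ∈ subdifferential F x) (B : ℝ) :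
    ∀ᶠ y in 𝓝 x, ∀ w ∈ subdifferential F y, ‖w‖ ≤ B →
      w ∈ subdifferential F x ∧ F y = ((a + ⟪w, y - x⟫_ℝ : ℝ) : EReal) := by
  obtain ⟨δ, hδ, hball⟩ := Metric.eventually_nhds_iff.1 (hP.eventually_epi_dilation hx)
  have h1 : Tendsto (fun y => (|B| + ‖u‖ + 1) * ‖y - x‖) (𝓝 x) (𝓝 0) := by
    have : Continuous fun y => (|B| + ‖u‖ + 1) * ‖y - x‖ := by fun_prop
    simpa using this.tendsto x
  filter_upwards [h1.eventually_lt_const hδ] with y hy w hw hwB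
  obtain ⟨r, hr⟩ := hF.exists_real_of_mem_subdifferential hw
  have hup := (mem_subdifferential_iff hr).1 hw _ (mem_epi_of_eq hx)
  have hlow := (mem_subdifferential_iff hx).1 hu _ (mem_epi_of_eq hr)
  simp only at hup hlow
  rw [← neg_sub y x, inner_neg_right] at hup
  have hd : ‖(y - x, r - a)‖ < δ := by
    have e1 := real_inner_le_norm w (y - x)
    have e2 := (abs_le.1 (abs_real_inner_le_norm u (y - x))).1
    have e3 : ‖w‖ * ‖y - x‖ ≤ |B| * ‖y - x‖ := by
      gcongr
      exact hwB.trans (le_abs_self B)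
    have e4 := norm_nonneg (y - x)
    have e5 : 0 ≤ ‖u‖ * ‖y - x‖ := by positivity
    have e6 : 0 ≤ |B| * ‖y - x‖ := by positivity
    rw [Prod.norm_mk, max_lt_iff, Real.norm_eq_abs, abs_lt]
    refine ⟨?_, ?_, ?_⟩ <;> linarith
  have hdil := hball (y := (y - x, r - a)) (by simpa [dist_eq_norm] using hd) (by
    simp only [add_sub_cancel]
    exact mem_epi_of_eq hr)
  -- the subgradient inequality at `x + 2 (y - x)` is the converse of the one at `x`
  have h2 := (mem_subdifferential_iff hr).1 hw _ hdil
  simp only at h2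
  rw [show x + (2 : ℝ) • (y - x) - y = y - x by module] at h2
  have hreq : r = a + ⟪w, y - x⟫_ℝ := by linarith
  refine ⟨(mem_subdifferential_iff hx).2 fun p hp => ?_, by rw [hr, hreq]⟩
  have h3 := (mem_subdifferential_iff hr).1 hw p hp
  rw [show p.1 - x = (p.1 - y) + (y - x) by abel, inner_add_right]
  linarith

/-- Near `x`, the partial smoothness manifold of a locally polyhedral function is `x + T_x`, and
the function is affine on it. A subgradient at a point `y` of the manifold close to the relative
interior point `u` of `∂F x` maximizes `⟪·, y - x⟫` over `∂F x`, so `y - x` is orthogonal to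
`∂F x`; the converse inclusion comes from the normal retraction. -/
theorem IsPartlySmooth.eventually_affine_of_polyhedral (h : IsPartlySmooth F M x)
    (hP : IsLocallyPolyhedralAt F x) (hx : F x = a) {u : E}
    (hu : u ∈ intrinsicInterior ℝ (subdifferential F x)) :
    (∀ᶠ y in 𝓝 x, (y ∈ M ↔ y - x ∈ sharpSubspace F x)) ∧
      ∀ᶠ y in 𝓝 x, y ∈ M → F y = ((a + ⟪u, y - x⟫_ℝ : ℝ) : EReal) := by
  have hu' := intrinsicInterior_subset hu
  obtain ⟨δ, hδ, hball⟩ := exists_ball_of_mem_intrinsicInterior hu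
  have hsub : ∀ᶠ y in 𝓝 x, y ∈ M → y - x ∈ sharpSubspace F x ∧
      F y = ((a + ⟪u, y - x⟫_ℝ : ℝ) : EReal) := by
    filter_upwards [eventually_nhdsWithin_iff.1
      (h.continuity.inner u hu' _ (Metric.ball_mem_nhds u hδ)),
      hP.eventually_subdifferential h.gammaZero hx hu' (‖u‖ + δ)] with y h1 h2 hy
    obtain ⟨w, hw, hwb⟩ := h1 hy
    rw [Metric.mem_ball, dist_eq_norm] at hwb
    obtain ⟨hwx, hFy⟩ := h2 w hw (by
      have := norm_add_le u (w - u)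
      rw [add_sub_cancel] at this
      linarith)
    have hmax : ∀ g ∈ subdifferential F x, ⟪g, y - x⟫_ℝ ≤ ⟪w, y - x⟫_ℝ := by
      intro g hg
      have := (mem_subdifferential_iff hx).1 hg _ (mem_epi_of_eq hFy)
      simp only at this
      linarith
    have hwu : w - u ∈ vectorSpan ℝ (subdifferential F x) := vsub_mem_vectorSpan ℝ hwx hu'
    have hle : ∀ d ∈ vectorSpan ℝ (subdifferential F x), ⟪d, y - x⟫_ℝ ≤ 0 := by
      intro d hd
      set t := (δ - ‖w - u‖) / (‖d‖ + 1) with ht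
      have htpos : 0 < t := div_pos (by linarith) (by positivity)
      have hnorm : ‖(w - u) + t • d‖ < δ := by
        refine (norm_add_le _ _).trans_lt ?_
        rw [norm_smul, Real.norm_of_nonneg htpos.le]
        have : t * (‖d‖ + 1) = δ - ‖w - u‖ := by
          rw [ht]; field_simp
        nlinarith
      have h3 := hmax _ (hball _ (Submodule.add_mem _ hwu (Submodule.smul_mem _ t hd)) hnorm)
      rw [show u + (w - u + t • d) = w + t • d by abel, inner_add_left,
        real_inner_smul_left] at h3
      by_contra hcon
      push Not at hcon
      nlinarith [mul_pos htpos hcon]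
    have hT : ∀ d ∈ vectorSpan ℝ (subdifferential F x), ⟪d, y - x⟫_ℝ = 0 := by
      intro d hd
      have h3 := hle _ (Submodule.neg_mem _ hd)
      rw [inner_neg_left] at h3
      linarith [hle d hd]
    refine ⟨(Submodule.mem_orthogonal _ _).2 hT, ?_⟩
    have h3 := hT _ hwu
    rw [inner_sub_left] at h3
    rw [hFy, show ⟪w, y - x⟫_ℝ = ⟪u, y - x⟫_ℝ by linarith]
  refine ⟨?_, hsub.mono fun y hy hyM => (hy hyM).2⟩
  obtain ⟨ψ, hψ, hψM⟩ := h.manifold.exists_normal_retraction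
  filter_upwards [hsub, hψ.eventually hsub, hψM] with y h1 h2 h3
  refine ⟨fun hy => (h1 hy).1, fun hy => ?_⟩
  have h4 : y - ψ y ∈ sharpSubspace F x := by
    have := Submodule.sub_mem _ hy (h2 h3.1).1
    rwa [sub_sub_sub_cancel_right] at this
  have h5 : y - ψ y ∈ (sharpSubspace F x)ᗮ := by
    rw [← h.sharp]
    exact h3.2
  have h6 : y - ψ y = 0 := inner_self_eq_zero.1 (Submodule.inner_right_of_mem_orthogonal h4 h5)
  rw [sub_eq_zero.1 h6]
  exact h3.1

/-- If `F` is affine on `M` near `y` with linear part `u`, its Riemannian gradient is the tangential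
part of `u`. -/
theorem hasRiemGradientAt_of_affine {T : Submodule ℝ E} {y u : E} (htan : tangentSpace M y = T)
    (hF : ∀ᶠ y' in 𝓝 y, y' ∈ M → F y' = ((a + ⟪u, y' - x⟫_ℝ : ℝ) : EReal)) :
    HasRiemGradientAt M F y (T.starProjection u) := by
  have hF' := eventually_nhdsWithin_iff.2 hF
  refine ⟨htan ▸ T.starProjection_apply_mem u, hF'.mono fun y' hy' => ?_, fun c h hc => ?_⟩
  · rw [hy']
    exact ⟨EReal.coe_ne_bot _, EReal.coe_ne_top _⟩
  · have hT : h ∈ T := htan ▸ Submodule.subset_span ⟨c, hc⟩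
    have h1 : HasDerivAt (fun t => a + ⟪u, c t - x⟫_ℝ) ⟪u, h⟫_ℝ 0 :=
      ((innerSL ℝ u).hasFDerivAt.comp_hasDerivAt (0 : ℝ) (hc.2.2.sub_const x)).const_add a
    have h2 : ⟪T.starProjection u, h⟫_ℝ = ⟪u, h⟫_ℝ := by
      have h3 := Submodule.inner_left_of_mem_orthogonal hT
        (Submodule.sub_starProjection_mem_orthogonal (K := T) u)
      rw [inner_sub_left] at h3
      linarith
    rw [h2]
    refine h1.congr_of_eventuallyEq ?_
    filter_upwards [hc.tendsto_nhdsWithin.eventually hF'] with t ht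
    rw [ht, EReal.toReal_coe]

theorem hasRiemHessianAt_zero_of_gradient_const {y g : E}
    (hg : ∀ᶠ y' in 𝓝[M] y, HasRiemGradientAt M F y' g) : HasRiemHessianAt M F y 0 := by
  refine ⟨fun _ => g, hg, fun h c _ => ⟨0, hasDerivAt_const _ _, ?_⟩⟩
  simp

/-- Gradients and Hessians of a partly smooth, locally polyhedral function along its manifold. -/
theorem IsPartlySmooth.eventually_riemGradient_riemHessian (h : IsPartlySmooth F M x)
    (hP : IsLocallyPolyhedralAt F x) (hx : F x = a) {u : E}
    (hu : u ∈ intrinsicInterior ℝ (subdifferential F x)) :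
    ∀ᶠ y in 𝓝 x, y ∈ M →
      HasRiemGradientAt M F y ((sharpSubspace F x).starProjection u) ∧
        HasRiemHessianAt M F y 0 := by
  obtain ⟨hM, hFa⟩ := h.eventually_affine_of_polyhedral hP hx hu
  have hgrad : ∀ᶠ y in 𝓝 x, y ∈ M →
      HasRiemGradientAt M F y ((sharpSubspace F x).starProjection u) := by
    filter_upwards [hM.eventually_nhds, hFa.eventually_nhds] with y h1 h2 hy
    exact hasRiemGradientAt_of_affine (tangentSpace_eq_of_eventually_affine hy h1) h2
  filter_upwards [hgrad, hgrad.eventually_nhds] with y h1 h2 hy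
  exact ⟨h1 hy, hasRiemHessianAt_zero_of_gradient_const (eventually_nhdsWithin_iff.2 h2)⟩

end Polyhedral

end DRSplitting

end

open DRSplitting
theorem theorem4p3 (n : ℕ)
    (G J : EuclideanSpace ℝ (Fin n) → EReal)
    (hG : IsGammaZero G) (hJ : IsGammaZero J)
    (hri : (intrinsicInterior ℝ (effDom G) ∩ intrinsicInterior ℝ (effDom J)).Nonempty)
    (hargmin : (argminSet (fun y => G y + J y)).Nonempty)
    (lam : ℕ → ℝ) (hlam : ∀ k, lam k ∈ Set.Icc (0 : ℝ) 2)
    (hlam_sum : Tendsto (fun N => ∑ k ∈ Finset.range N, lam k * (2 - lam k)) atTop atTop)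
    (γs : ℕ → ℝ) (γ : ℝ) (hγs : ∀ k, 0 < γs k) (hγ : 0 < γ)
    (hγ_sum : Summable (fun k => lam k * |γs k - γ|))
    (hγ_conv : ∃ l : ℝ, Tendsto γs atTop (𝓝 l))
    (hγ_low : ∃ γlow : ℝ, 0 < γlow ∧ ∀ k, γlow ≤ γs k)
    (z x v : ℕ → EuclideanSpace ℝ (Fin n))
    (hDR : IsNonstationaryDR G J γs lam z x v) :
    ∃ zs xs : EuclideanSpace ℝ (Fin n),
      Tendsto z atTop (𝓝 zs) ∧ Tendsto x atTop (𝓝 xs) ∧ Tendsto v atTop (𝓝 xs) ∧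
      Function.IsFixedPt (drOperator γ G J) zs ∧ xs = prox γ J zs ∧
      xs ∈ argminSet (fun y => G y + J y) ∧
      ∀ MG MJ : Set (EuclideanSpace ℝ (Fin n)),
        IsPartlySmooth G MG xs → IsPartlySmooth J MJ xs →
        xs - zs ∈ γ • intrinsicInterior ℝ (subdifferential G xs) →
        zs - xs ∈ γ • intrinsicInterior ℝ (subdifferential J xs) →
        ∃ K : ℕ,
          -- finite identification
          (∀ k ≥ K, v k ∈ MG ∧ x k ∈ MJ) ∧
          -- affine manifolds
          ((∀ᶠ y in 𝓝 xs, (y ∈ MJ ↔ y - xs ∈ sharpSubspace J xs)) →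
            ∀ k ≥ K, sharpSubspace J (x k) = sharpSubspace J xs ∧
              tangentSpace MJ (x k) = sharpSubspace J xs) ∧
          ((∀ᶠ y in 𝓝 xs, (y ∈ MG ↔ y - xs ∈ sharpSubspace G xs)) →
            ∀ k ≥ K, sharpSubspace G (v k) = sharpSubspace G xs ∧
              tangentSpace MG (v k) = sharpSubspace G xs) ∧
          -- locally polyhedral functions
          (IsLocallyPolyhedralAt J xs →
            (∀ᶠ y in 𝓝 xs, (y ∈ MJ ↔ y - xs ∈ sharpSubspace J xs)) ∧
            ∃ g : EuclideanSpace ℝ (Fin n), HasRiemGradientAt MJ J xs g ∧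
              ∀ k ≥ K, x k - xs ∈ sharpSubspace J xs ∧
                sharpSubspace J (x k) = sharpSubspace J xs ∧
                tangentSpace MJ (x k) = sharpSubspace J xs ∧
                HasRiemGradientAt MJ J (x k) g ∧ HasRiemHessianAt MJ J (x k) 0) ∧
          (IsLocallyPolyhedralAt G xs →
            (∀ᶠ y in 𝓝 xs, (y ∈ MG ↔ y - xs ∈ sharpSubspace G xs)) ∧
            ∃ g : EuclideanSpace ℝ (Fin n), HasRiemGradientAt MG G xs g ∧
              ∀ k ≥ K, v k - xs ∈ sharpSubspace G xs ∧
                sharpSubspace G (v k) = sharpSubspace G xs ∧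
                tangentSpace MG (v k) = sharpSubspace G xs ∧
                HasRiemGradientAt MG G (v k) g ∧ HasRiemHessianAt MG G (v k) 0) := by
  have hx : ∀ k, x k = prox (γs k) J (z k) := fun k => by
    cases k with
    | zero => exact hDR.x_zero
    | succ k => exact hDR.x_succ k
  have hγlim : Tendsto γs atTop (𝓝 γ) := tendsto_step_size hlam hlam_sum hγ_sum hγ_conv
  obtain ⟨x₀, hx₀⟩ := hargmin
  obtain ⟨u, huG, huJ⟩ := exists_subgradient_of_mem_argminSet hG hJ hri hx₀
  obtain ⟨zs, hfix, hz⟩ := hDR.exists_tendsto hG hJ hlam hlam_sum hγs hγ hγ_sum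
    (rprox_rprox_eq_of_subgradients hG hJ hγ huG huJ)
  set xs := prox γ J zs with hxs
  have hpG : prox γ G ((2 : ℝ) • xs - zs) = xs := prox_eq_of_rprox_rprox_eq hfix
  have hxlim : Tendsto x atTop (𝓝 xs) :=
    (hJ.tendsto_prox hγ hγs hγlim hz).congr fun k => (hx k).symm
  have hylim : Tendsto (fun k => (2 : ℝ) • x k - z k) atTop (𝓝 ((2 : ℝ) • xs - zs)) :=
    (hxlim.const_smul _).sub hz
  have hvlim' : Tendsto (fun k => v (k + 1)) atTop (𝓝 xs) := by
    have h1 := hG.tendsto_prox hγ hγs hγlim hylim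
    rw [hpG] at h1
    exact h1.congr fun k => (hDR.v_succ k).symm
  have hvlim : Tendsto v atTop (𝓝 xs) := (tendsto_add_atTop_iff_nat 1).1 hvlim'
  have hγinv : Tendsto (fun k => (γs k)⁻¹) atTop (𝓝 γ⁻¹) := hγlim.inv₀ hγ.ne'
  have hJsub : γ⁻¹ • (zs - xs) ∈ subdifferential J xs := hJ.prox_subgradient hγ zs
  have hGsub : γ⁻¹ • (xs - zs) ∈ subdifferential G xs := by
    have h1 := hG.prox_subgradient hγ ((2 : ℝ) • xs - zs)
    rw [hpG] at h1
    convert h1 using 2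
    module
  refine ⟨zs, xs, hz, hxlim, hvlim, ?_, rfl, ?_, ?_⟩
  · change drOperator γ G J zs = zs
    rw [drOperator, hfix]
    module
  · refine mem_argminSet_add_of_subgradient hG hJ hGsub ?_
    rwa [← smul_neg, neg_sub]
  intro MG MJ hPG hPJ hNDG hNDJ
  rw [Set.mem_smul_set_iff_inv_smul_mem₀ hγ.ne'] at hNDG hNDJ
  obtain ⟨a, ha⟩ := hG.exists_real_of_mem_subdifferential hGsub
  obtain ⟨b, hb⟩ := hJ.exists_real_of_mem_subdifferential hJsub
  -- identification of the two manifolds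
  have hvM : ∀ᶠ k in atTop, v k ∈ MG := by
    have h1 : Tendsto (fun k => (γs k)⁻¹ • ((2 : ℝ) • x k - z k - v (k + 1))) atTop
        (𝓝 (γ⁻¹ • (xs - zs))) := by
      have h2 := hγinv.smul (hylim.sub hvlim')
      rwa [show (2 : ℝ) • xs - zs - xs = xs - zs by module] at h2
    rw [← map_add_atTop_eq_nat 1, eventually_map]
    filter_upwards [(hvlim'.prodMk_nhds h1).eventually (hPG.eventually_mem hNDG)] with k hk
    refine hk ?_
    simp only [hDR.v_succ]
    exact hG.prox_subgradient (hγs k) _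
  have hxM : ∀ᶠ k in atTop, x k ∈ MJ := by
    have h1 : Tendsto (fun k => (γs k)⁻¹ • (z k - x k)) atTop (𝓝 (γ⁻¹ • (zs - xs))) :=
      hγinv.smul (hz.sub hxlim)
    filter_upwards [(hxlim.prodMk_nhds h1).eventually (hPJ.eventually_mem hNDJ)] with k hk
    refine hk ?_
    simp only [hx]
    exact hJ.prox_subgradient (hγs k) _
  -- consequences along the sequences of the local descriptions of the manifolds
  have hJaff := eventually_imp_distrib_left.2 fun hM : ∀ᶠ y in 𝓝 xs, (y ∈ MJ ↔
    y - xs ∈ sharpSubspace J xs) => hxlim.eventually (hM.and (hPJ.eventually_sharpSubspace_eq hM))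
  have hGaff := eventually_imp_distrib_left.2 fun hM : ∀ᶠ y in 𝓝 xs, (y ∈ MG ↔
    y - xs ∈ sharpSubspace G xs) => hvlim.eventually (hM.and (hPG.eventually_sharpSubspace_eq hM))
  have hJpol := eventually_imp_distrib_left.2 fun hP : IsLocallyPolyhedralAt J xs =>
    hxlim.eventually (hPJ.eventually_riemGradient_riemHessian hP hb hNDJ)
  have hGpol := eventually_imp_distrib_left.2 fun hP : IsLocallyPolyhedralAt G xs =>
    hvlim.eventually (hPG.eventually_riemGradient_riemHessian hP ha hNDG)
  obtain ⟨K, hK⟩ := eventually_atTop.1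
    (hvM.and (hxM.and (hJaff.and (hGaff.and (hJpol.and hGpol)))))
  refine ⟨K, fun k hk => ⟨(hK k hk).1, (hK k hk).2.1⟩, fun hM k hk => ?_, fun hM k hk => ?_,
    fun hP => ?_, fun hP => ?_⟩
  · obtain ⟨-, hxk, hJk, -⟩ := hK k hk
    exact (hJk hM).2 hxk
  · obtain ⟨hvk, -, -, hGk, -⟩ := hK k hk
    exact (hGk hM).2 hvk
  · have hM := (hPJ.eventually_affine_of_polyhedral hP hb hNDJ).1
    refine ⟨hM, _, (hPJ.eventually_riemGradient_riemHessian hP hb hNDJ).self_of_nhds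
      hPJ.manifold.1 |>.1, fun k hk => ?_⟩
    obtain ⟨-, hxk, hJk, -, hpk, -⟩ := hK k hk
    obtain ⟨h1, h2⟩ := hJk hM
    exact ⟨h1.1 hxk, (h2 hxk).1, (h2 hxk).2, (hpk hP hxk).1, (hpk hP hxk).2⟩
  · have hM := (hPG.eventually_affine_of_polyhedral hP ha hNDG).1
    refine ⟨hM, _, (hPG.eventually_riemGradient_riemHessian hP ha hNDG).self_of_nhds
      hPG.manifold.1 |>.1, fun k hk => ?_⟩
    obtain ⟨hvk, -, -, hGk, -, hpk⟩ := hK k hk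
    obtain ⟨h1, h2⟩ := hGk hM
    exact ⟨h1.1 hvk, (h2 hvk).1, (h2 hvk).2, (hpk hP hvk).1, (hpk hP hvk).2⟩
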